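/- A permutation is a finite word without repeated letters over the positive integers, and $S_n$ is the set of permutations of $\{1,\ldots,n\}$, written in one-line notation. The stack-sorting map $s$ sends the empty word to itself and satisfies $s(LmR)=s(L)\,s(R)\,m$, where $m$ is the largest letter. A permutation $\pi$ is uniquely sorted if it has exactly one preimage under $s$. A permutation contains a pattern $\tau$ if some subword of it has the same relative order as $\tau$, and avoids $\tau$ otherwise. Let $\mathcal U_n(\tau^{(1)},\ldots,\tau^{(r)})$ be the set of uniquely sorted permutations in $S_n$ that avoid $\tau^{(1)},\ldots,\tau^{(r)}$. For $\pi\in S_n$, let $\operatorname{rot}(\pi)$ be the reverse of $\pi^{-1}$ (the plot of $\pi$ rotated counterclockwise by $90^\circ$). For $1\le i\le n$, let $\mathsf{swu}_i(\pi)$ be obtained from $\pi$ by keeping the entries that are at least $i$, replacing the $m$-th smallest of the entries that are less than $i$ and lie to the right of $i$ by $m$, and replacing the $m$-th largest of the entries that are less than $i$ and lie to the left of $i$ by $i-m$ (for all $m$). Put $\mathsf{swl}_i=\operatorname{rot}^{-1}\circ\mathsf{swu}_i\circ\operatorname{rot}$ and $\mathsf{swl}=\mathsf{swl}_1\circ\mathsf{swl}_2\circ\cdots\circ\mathsf{swl}_n$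 on $S_n$. Let $\operatorname{Des}(\pi)=\{i\in\{1,\ldots,n-1\}:\pi_i>\pi_{i+1}\}$. For $\pi\in\mathcal U_{2k+1}(312)$, let $\mathrm{DL}_k(\pi)=(\Lambda,\Lambda')$, where $\Lambda=\Lambda_1\cdots\Lambda_{2k}$ and $\Lambda'=\Lambda'_1\cdots\Lambda'_{2k}$ are the words over $\{U,D\}$ such that $\Lambda_i=D$ if and only if $2k+1-i\in\operatorname{Des}(\pi)$, and $\Lambda'_i=U$ if and only if $i\in\operatorname{Des}(\operatorname{rot}(\pi))$. A Dyck path of semilength $k$ is a word with $k$ letters $U$ and $k$ letters $D$, every prefix of which has at least as many $U$'s as $D$'s. Let $\mathcal A_k$ be the antichain (the poset without nontrivial relations) on the set of Dyck paths of semilength $k$, and let $\operatorname{Int}(\mathcal A_k)$ be the set of pairs $(x,y)$ of elements of $\mathcal A_k$ with $x\le y$. Theorem. For each nonnegative integer $k$, the map $\mathsf{swl}$ sends $\mathcal U_{2k+1}(132,231)$ into $\mathcal U_{2k+1}(312)$, and $\mathrm{DL}_k\circ\mathsf{swl}$ restricts to a bijection from $\mathcal U_{2k+1}(132,231)$ to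 $\operatorname{Int}(\mathcal A_k)$. Hence $|\mathcal U_{2k+1}(132,231)|=C_k=\frac1{k+1}\binom{2k}{k}$. -/

import Mathlib

/-! Permutations are words: lists of distinct positive integers, in one-line notation.
Positions and descents are numbered from `1`. -/

namespace CatalanPerm

/-- Permutations: finite words without repeated letters over the positive integers. -/
def IsPermWord (p : List ℕ) : Prop := p.Nodup ∧ ∀ v ∈ p, 0 < v

/-- `S_n`: the orderings of `1, …, n`. -/
def S (n : ℕ) : Set (List ℕ) := {p | p.Perm (List.range' 1 n)}

/-! ### Stack-sorting -/

/-- The largest letter of a word (`0` for the empty word). -/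
def maxLetter (p : List ℕ) : ℕ := p.foldr max 0

theorem maxLetter_mem : ∀ (p : List ℕ), p ≠ [] → maxLetter p ∈ p
  | [], h => absurd rfl h
  | [a], _ => by simp [maxLetter]
  | a :: b :: l, _ => by
    have ih : maxLetter (b :: l) ∈ b :: l := maxLetter_mem (b :: l) (by simp)
    have e : maxLetter (a :: b :: l) = max a (maxLetter (b :: l)) := rfl
    rw [e]
    rcases max_choice a (maxLetter (b :: l)) with h | h <;> rw [h]
    · exact List.mem_cons_self
    · exact List.mem_cons_of_mem _ ih

/-- West's stack-sorting map: `s` of the empty word is empty, and `s(L m R) = s(L) s(R) m`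
where `m` is the largest letter. -/
def stackSort (p : List ℕ) : List ℕ :=
  if _h : p = [] then []
  else
    stackSort (p.take (p.idxOf (maxLetter p))) ++
      stackSort (p.drop (p.idxOf (maxLetter p) + 1)) ++ [maxLetter p]
termination_by p.length
decreasing_by
  · have := List.idxOf_lt_length_of_mem (maxLetter_mem p _h)
    simp only [List.length_take]
    omega
  · have := List.length_pos_iff.mpr _h
    simp only [List.length_drop]
    omega

/-- The fertility of `p`: the number of preimages of `p` under the stack-sorting map. -/
noncomputable def fertility (p : List ℕ) : ℕ :=
  Set.ncard {q : List ℕ | IsPermWord q ∧ stackSort q = p}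

/-! ### Patterns -/

/-- The normalization of a word: its `i`-th smallest letter is replaced by `i`. -/
def normalize (p : List ℕ) : List ℕ := p.map fun v => p.countP fun u => u ≤ v

/-- `p` contains the pattern `t`: some subword of `p` has the same relative order as `t`. -/
def ContainsPattern (p t : List ℕ) : Prop :=
  ∃ q : List ℕ, q.Sublist p ∧ normalize q = normalize t

/-- `U_n(T)`: the uniquely sorted permutations in `S_n` (those of fertility `1`) that avoid
all the patterns in `T`. -/
def U (n : ℕ) (T : Set (List ℕ)) : Set (List ℕ) :=
  {p | p ∈ S n ∧ fertility p = 1 ∧ ∀ t ∈ T, ¬ ContainsPattern p t}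

/-! ### Rotations and sliding operators, on `S_n` -/

/-- The inverse of a permutation in `S_n`: its `v`-th entry is the position of `v` in `p`. -/
def inv (p : List ℕ) : List ℕ := (List.range' 1 p.length).map fun v => p.idxOf v + 1

/-- Rotation of the plot by 90 degrees counterclockwise. -/
def rot (p : List ℕ) : List ℕ := (inv p).reverse

/-- Rotation of the plot by 90 degrees clockwise, the inverse of `rot`. -/
def rotInv (p : List ℕ) : List ℕ := inv p.reverse

/-- The letters smaller than `i` to the left of `i` in `p`. -/
def leftSmaller (i : ℕ) (p : List ℕ) : List ℕ := (p.take (p.idxOf i)).filter fun v => v < i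

/-- The letters smaller than `i` to the right of `i` in `p`. -/
def rightSmaller (i : ℕ) (p : List ℕ) : List ℕ := (p.drop (p.idxOf i)).filter fun v => v < i

/-- `swu_i`: entries `≥ i` are kept, the `m`-th smallest entry of `rightSmaller i p` becomes `m`,
the `m`-th largest entry of `leftSmaller i p` becomes `i - m`. -/
def swuAt (i : ℕ) (p : List ℕ) : List ℕ :=
  p.map fun v =>
    if i ≤ v then v
    else if v ∈ rightSmaller i p then (rightSmaller i p).countP fun u => u ≤ v
    else i - (leftSmaller i p).countP fun u => v ≤ u

/-- `swl_i = rot⁻¹ ∘ swu_i ∘ rot`. -/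
def swlAt (i : ℕ) (p : List ℕ) : List ℕ := rotInv (swuAt i (rot p))

/-- `swl = swl_1 ∘ swl_2 ∘ ⋯ ∘ swl_n` on `S_n`; in particular `swl_n` is applied first. -/
def swl (p : List ℕ) : List ℕ := (List.range' 1 p.length).foldr swlAt p

/-! ### The map `DL_k` -/

/-- `Des(p)`: the indices `1 ≤ i < n` with `p_i > p_{i+1}`, where `n` is the length of `p`
(the entry `p_i` has list index `i - 1`). -/
def Des (p : List ℕ) : Finset ℕ :=
  (Finset.Ico 1 p.length).filter fun i => p.getD i 0 < p.getD (i - 1) 0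

/-- `DL_k(p) = (Λ, Λ')` for `p` of length `2k+1`: for `1 ≤ i ≤ 2k`, the letter `Λ_i` is `D`
iff `2k+1-i ∈ Des(p)`, and `Λ'_i` is `U` iff `i ∈ Des(rot p)`. -/
def DL (k : ℕ) (p : List ℕ) : List DyckStep × List DyckStep :=
  ((List.range' 1 (2 * k)).map fun i =>
      if 2 * k + 1 - i ∈ Des p then DyckStep.D else DyckStep.U,
   (List.range' 1 (2 * k)).map fun i =>
      if i ∈ Des (rot p) then DyckStep.U else DyckStep.D)

/-! ### The Catalan antichain and its intervals -/

/-- The underlying set of the antichain `A_k`: the Dyck paths of semilength `k`. -/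
def CatalanAntichain (k : ℕ) : Type := {w : DyckWord // w.semilength = k}

/-- The antichain order: no relations except `x ≤ x`. -/
instance (k : ℕ) : PartialOrder (CatalanAntichain k) where
  le x y := x = y
  le_refl _ := rfl
  le_trans _ _ _ h₁ h₂ := h₁.trans h₂
  le_antisymm _ _ h _ := h

/-- `Int(A_k)`: the pairs `(x, y)` in `A_k` with `x ≤ y`, each Dyck path written as a word
in `U` and `D`. -/
def IntAntichain (k : ℕ) : Set (List DyckStep × List DyckStep) :=
  Set.range fun I : NonemptyInterval (CatalanAntichain k) =>
    (I.fst.val.toList, I.snd.val.toList)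

end CatalanPerm

/-! A permutation avoids 132 and 231 exactly when it decreases to 1 and then increases. Such a
permutation is coded by a word `w` that tells, from the largest letter down, on which side of 1 each
letter lies (`valley`). The proof shows that unique sortedness means that `w` is a Dyck word, and
that `DL k ∘ swl` sends `valley w` to `(w, w)`. The intervals of an antichain are precisely these
diagonal pairs, so the bijection and the Catalan count follow.

Unique sortedness rests on a criterion: a nonempty permutation is uniquely sorted iff it is sorted
and its length is twice its number of descents plus one (`fertility_eq_one_iff_tight`). For `valley
w` the descents are the letters `D`, and being sorted amounts to the ballot condition on the
prefixes of `w` (`fertility_valley`).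

For the image, `rot (valley w)` avoids 213 and has descent word `w`. Each `swu_i` preserves both
properties and removes the patterns 132 whose largest letter is `i` (`Slid.slide`). The result `r`
avoids 132 and 213, so it consists of increasing runs, each lying entirely above the next. This
shape makes the reverse of `rotInv r` have the same descent word as `r`, whence both coordinates
equal `w`. That reverse avoids 132 and 213 as well, so `rotInv r` avoids 312. It is sorted by
recursion on the decomposition `U x D y` of a Dyck word, and it has the right number of descents to
be uniquely sorted. -/

namespace CatalanPerm

/-! ### Preimages under stack-sorting -/

/-- `SortsTo q p`: the stack-sorting map sends `q`, a word without repeated letters, to `p`. -/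
inductive SortsTo : List ℕ → List ℕ → Prop
  | nil : SortsTo [] []
  | node {L R A B : List ℕ} {m : ℕ} (hL : ∀ x ∈ L, x < m) (hR : ∀ x ∈ R, x < m)
      (hA : SortsTo L A) (hB : SortsTo R B) : SortsTo (L ++ m :: R) (A ++ B ++ [m])

theorem SortsTo.perm {q p : List ℕ} (h : SortsTo q p) : q.Perm p := by
  induction h with
  | nil => exact .nil
  | @node L R A B m _ _ _ _ ihA ihB =>
    refine List.perm_middle.trans ?_
    refine ((ihA.append ihB).cons m).trans ?_
    exact (List.perm_append_comm (l₁ := [m]) (l₂ := A ++ B))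

theorem le_maxLetter {p : List ℕ} {v : ℕ} (h : v ∈ p) : v ≤ maxLetter p := by
  induction p with
  | nil => simp at h
  | cons a l ih =>
    change v ≤ max a (maxLetter l)
    rcases List.mem_cons.1 h with rfl | h
    · exact le_max_left _ _
    · exact (ih h).trans (le_max_right _ _)

theorem maxLetter_append_cons {L R : List ℕ} {m : ℕ} (hL : ∀ x ∈ L, x < m)
    (hR : ∀ x ∈ R, x < m) : maxLetter (L ++ m :: R) = m := by
  apply le_antisymm
  · have := maxLetter_mem (L ++ m :: R) (by simp)
    rcases List.mem_append.1 this with h | h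
    · exact (hL _ h).le
    · rcases List.mem_cons.1 h with h | h
      · exact h.le
      · exact (hR _ h).le
  · exact le_maxLetter (by simp)

theorem stackSort_append_cons {L R : List ℕ} {m : ℕ} (hL : ∀ x ∈ L, x < m)
    (hR : ∀ x ∈ R, x < m) :
    stackSort (L ++ m :: R) = stackSort L ++ stackSort R ++ [m] := by
  rw [stackSort, dif_neg (by simp), maxLetter_append_cons hL hR]
  have hm : m ∉ L := fun h => lt_irrefl _ (hL m h)
  have e : (L ++ m :: R).idxOf m = L.length := by
    rw [List.idxOf_append_of_notMem hm]; simp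
  rw [e]
  simp

theorem SortsTo.stackSort_eq {q p : List ℕ} (h : SortsTo q p) : stackSort q = p := by
  induction h with
  | nil => rw [stackSort]; simp
  | node hL hR _ _ ihA ihB => rw [stackSort_append_cons hL hR, ihA, ihB]

theorem sortsTo_stackSort (q : List ℕ) (hq : q.Nodup) : SortsTo q (stackSort q) := by
  induction hn : q.length using Nat.strong_induction_on generalizing q with
  | _ n ih =>
    rcases eq_or_ne q [] with rfl | h0
    · rw [stackSort]; simpa using SortsTo.nil
    · obtain ⟨L, R, e⟩ := List.append_of_mem (maxLetter_mem q h0)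
      have hle : ∀ x ∈ q, x ≤ maxLetter q := fun x hx => le_maxLetter hx
      generalize maxLetter q = m at e hle
      subst e
      have hq' := hq
      rw [List.nodup_append] at hq
      obtain ⟨h1, h2, h3⟩ := hq
      rw [List.nodup_cons] at h2
      have hL : ∀ x ∈ L, x < m := fun x hx =>
        lt_of_le_of_ne (hle x (by simp [hx])) (h3 x hx m (by simp))
      have hR : ∀ x ∈ R, x < m := fun x hx =>
        lt_of_le_of_ne (hle x (by simp [hx])) (fun e => h2.1 (e ▸ hx))
      rw [stackSort_append_cons hL hR]
      simp only [List.length_append, List.length_cons] at hn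
      exact .node hL hR (ih _ (by omega) L h1 rfl) (ih _ (by omega) R h2.2 rfl)

theorem fertility_eq_one_iff {p : List ℕ} (hp : IsPermWord p) :
    fertility p = 1 ↔ ∃! q, SortsTo q p := by
  have e : {q : List ℕ | IsPermWord q ∧ stackSort q = p} = {q | SortsTo q p} := by
    ext q
    constructor
    · rintro ⟨h, rfl⟩
      exact sortsTo_stackSort q h.1
    · intro h
      exact ⟨⟨h.perm.nodup_iff.2 hp.1, fun v hv => hp.2 v (h.perm.mem_iff.1 hv)⟩,
        h.stackSort_eq⟩
  rw [fertility, e, Set.ncard_eq_one]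
  constructor
  · rintro ⟨q, hq⟩
    have : ∀ r, SortsTo r p ↔ r = q := fun r => by
      rw [← Set.mem_singleton_iff, ← hq, Set.mem_ofPred_eq]
    exact ⟨q, (this q).2 rfl, fun r hr => (this r).1 hr⟩
  · rintro ⟨q, hq, hu⟩
    exact ⟨q, Set.ext fun r =>
      ⟨fun h => hu r h, fun h => by rw [Set.mem_singleton_iff.1 h]; exact hq⟩⟩

theorem SortsTo.inv {q p : List ℕ} (h : SortsTo q p) (hp : p ≠ []) :
    ∃ L R A B m, q = L ++ m :: R ∧ p = A ++ B ++ [m] ∧ (∀ x ∈ L, x < m) ∧ (∀ x ∈ R, x < m) ∧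
      SortsTo L A ∧ SortsTo R B := by
  cases h with
  | nil => exact absurd rfl hp
  | node hL hR hA hB => exact ⟨_, _, _, _, _, rfl, rfl, hL, hR, hA, hB⟩

theorem SortsTo.exists_max {q p : List ℕ} (h : SortsTo q p) (hp : p ≠ []) :
    ∃ p' m, p = p' ++ [m] ∧ ∀ x ∈ p', x < m := by
  obtain ⟨L, R, A, B, m, rfl, rfl, hL, hR, hA, hB⟩ := h.inv hp
  refine ⟨A ++ B, m, rfl, fun x hx => ?_⟩
  rcases List.mem_append.1 hx with hx | hx
  · exact hL x (hA.perm.mem_iff.2 hx)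
  · exact hR x (hB.perm.mem_iff.2 hx)

/-! ### Counting descents and ascents by their tops -/

/-- The number of descents of `p` whose top is at least `t`. -/
def descCount (t : ℕ) : List ℕ → ℕ
  | [] => 0
  | [_] => 0
  | a :: b :: l => (if b < a ∧ t ≤ a then 1 else 0) + descCount t (b :: l)

/-- The number of ascents of `p` whose top is at least `t`. -/
def ascCount (t : ℕ) : List ℕ → ℕ
  | [] => 0
  | [_] => 0
  | a :: b :: l => (if a < b ∧ t ≤ b then 1 else 0) + ascCount t (b :: l)

theorem descCount_append (t a b : ℕ) (l r : List ℕ) :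
    descCount t (l ++ [a] ++ b :: r) =
      descCount t (l ++ [a]) + (if b < a ∧ t ≤ a then 1 else 0) + descCount t (b :: r) := by
  induction l with
  | nil => simp [descCount]
  | cons c l ih =>
    cases l with
    | nil => simp [descCount, Nat.add_assoc]
    | cons d l =>
      simp only [List.cons_append] at ih
      simp only [List.cons_append, descCount, ih, Nat.add_assoc]

theorem ascCount_append (t a b : ℕ) (l r : List ℕ) :
    ascCount t (l ++ [a] ++ b :: r) =
      ascCount t (l ++ [a]) + (if a < b ∧ t ≤ b then 1 else 0) + ascCount t (b :: r) := by
  induction l with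
  | nil => simp [ascCount]
  | cons c l ih =>
    cases l with
    | nil => simp [ascCount, Nat.add_assoc]
    | cons d l =>
      simp only [List.cons_append] at ih
      simp only [List.cons_append, ascCount, ih, Nat.add_assoc]

theorem descCount_add_ascCount (p : List ℕ) (hp : p.Nodup) :
    descCount 0 p + ascCount 0 p = p.length - 1 := by
  induction p with
  | nil => rfl
  | cons a l ih =>
    cases l with
    | nil => rfl
    | cons b l =>
      have := ih (List.nodup_cons.1 hp).2
      have hab : a ≠ b := fun h => (List.nodup_cons.1 hp).1 (by simp [h])
      simp only [descCount, ascCount, List.length_cons] at this ⊢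
      rcases lt_or_gt_of_ne hab with h | h
      · simp [h, not_lt.2 h.le]; omega
      · simp [h, not_lt.2 h.le]; omega

theorem descCount_concat (t m : ℕ) (l : List ℕ) (h : ∀ x ∈ l, x < m) :
    descCount t (l ++ [m]) = descCount t l := by
  rcases List.eq_nil_or_concat' l with rfl | ⟨l, a, rfl⟩
  · rfl
  · rw [descCount_append]
    have := h a (by simp)
    simp [descCount, not_lt.2 this.le]

theorem ascCount_concat (t m : ℕ) (l : List ℕ) (h : ∀ x ∈ l, x < m) (hl : l ≠ []) :
    ascCount t (l ++ [m]) = ascCount t l + if t ≤ m then 1 else 0 := by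
  rcases List.eq_nil_or_concat' l with rfl | ⟨l, a, rfl⟩
  · exact absurd rfl hl
  · rw [ascCount_append]
    have := h a (by simp)
    simp [ascCount, this]

theorem descCount_append_le (t m : ℕ) (l r : List ℕ) (hl : ∀ x ∈ l, x < m) (hr : r ≠ []) :
    descCount t (l ++ r) ≤ descCount t l + (if t ≤ m then 1 else 0) + descCount t r := by
  rcases List.eq_nil_or_concat' l with rfl | ⟨l, a, rfl⟩
  · simp [descCount]
  · obtain ⟨b, r, rfl⟩ := List.exists_cons_of_ne_nil hr
    rw [descCount_append]
    have := hl a (by simp)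
    split_ifs <;> omega

theorem ascCount_le_append (t : ℕ) (l r : List ℕ) :
    ascCount t l + ascCount t r ≤ ascCount t (l ++ r) := by
  rcases List.eq_nil_or_concat' l with rfl | ⟨l, a, rfl⟩
  · simp [ascCount]
  · rcases r with - | ⟨b, r⟩
    · simp [ascCount]
    · rw [ascCount_append]; omega

/-- In every suffix of a sorted word, the ascents outnumber the descents, even if only those with
large tops are counted. -/
theorem SortsTo.descCount_le_ascCount (t : ℕ) {q p : List ℕ} (h : SortsTo q p) :
    ∀ l r, p = l ++ r → descCount t r ≤ ascCount t r := by
  induction h with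
  | nil =>
    intro l r h
    have : r = [] := by simpa using (List.append_eq_nil_iff.1 h.symm).2
    subst this; simp [descCount]
  | @node L R A B m hL hR hA hB ihA ihB =>
    have hA' : ∀ x ∈ A, x < m := fun x hx => hL x (hA.perm.mem_iff.2 hx)
    have hB' : ∀ x ∈ B, x < m := fun x hx => hR x (hB.perm.mem_iff.2 hx)
    have key : ∀ r, descCount t r ≤ ascCount t r → (∀ x ∈ r, x < m) →
        descCount t (r ++ [m]) ≤ ascCount t (r ++ [m]) := by
      intro r hr hm
      rcases eq_or_ne r [] with rfl | h0
      · simp [descCount]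
      · rw [descCount_concat t m r hm, ascCount_concat t m r hm h0]; omega
    intro l r h
    rcases List.eq_nil_or_concat' r with rfl | ⟨r, x, rfl⟩
    · simp [descCount]
    rw [← List.append_assoc] at h
    obtain ⟨h', hx⟩ := List.append_inj' h rfl
    obtain rfl : m = x := by simpa using hx
    rcases List.append_eq_append_iff.1 h' with ⟨C, h1, h2⟩ | ⟨C, h1, h2⟩
    · exact key r (ihB C r h2) fun x hx => hB' x (by simp [h2, hx])
    · subst h2
      have hC : ∀ x ∈ C, x < m := fun x hx => hA' x (by simp [h1, hx])
      have h3 := ihA l C h1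
      have h4 := ihB [] B rfl
      rcases eq_or_ne B [] with rfl | h0
      · rw [List.append_nil]; exact key C h3 hC
      · have hCB : ∀ x ∈ C ++ B, x < m := fun x hx =>
          (List.mem_append.1 hx).elim (hC x) (hB' x)
        rw [descCount_concat t m _ hCB, ascCount_concat t m _ hCB (by simp [h0])]
        have h5 := descCount_append_le t m C B hC h0
        have h6 := ascCount_le_append t C B
        omega

theorem SortsTo.two_mul_descCount_lt {q l r : List ℕ} (h : SortsTo q (l ++ r))
    (hn : (l ++ r).Nodup) (hr : r ≠ []) : 2 * descCount 0 r + 1 ≤ r.length := by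
  have h1 := h.descCount_le_ascCount 0 l r rfl
  have h2 := descCount_add_ascCount r (List.nodup_append.1 hn).2.1
  have := List.length_pos_iff.2 hr
  omega

/-! ### Uniquely sorted words -/

/-- Each nonempty sorted factor has length at least twice its descents plus one. Two factors thus
exceed the allowed length by two unless the junction is itself a descent and both bounds are
equalities. -/
theorem SortsTo.tight_split {L R A B : List ℕ} (hA : SortsTo L A) (hB : SortsTo R B)
    (hn : (A ++ B).Nodup) (h : (A ++ B).length = 2 * descCount 0 (A ++ B)) (h0 : A ++ B ≠ []) :
    ∃ A' a b B', A = A' ++ [a] ∧ B = b :: B' ∧ b < a ∧ A.length = 2 * descCount 0 A + 1 ∧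
      B.length = 2 * descCount 0 B + 1 := by
  rcases List.eq_nil_or_concat' A with rfl | ⟨A, a, rfl⟩
  · have := hB.two_mul_descCount_lt (l := []) hn h0
    simp only [List.nil_append] at *; omega
  rcases B with - | ⟨b, B⟩
  · have := hA.two_mul_descCount_lt (l := []) (r := A ++ [a]) (by simpa using hn) (by simp)
    simp only [List.append_nil] at *; omega
  have h1 := hA.two_mul_descCount_lt (l := []) (r := A ++ [a]) (List.nodup_append.1 hn).1 (by simp)
  have h2 := hB.two_mul_descCount_lt (l := []) (r := b :: B) (List.nodup_append.1 hn).2.1 (by simp)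
  rw [descCount_append, List.length_append] at h
  refine ⟨A, a, b, B, rfl, rfl, ?_⟩
  split_ifs at h with hc
  · exact ⟨hc.1, by omega, by omega⟩
  · omega

/-- This forces the place of the cut. Were `A'` longer than `A`, its last letter `c` would lie in
`B`, and `c` followed by `B'` would be a suffix of `B`. As `B'` is already tight and `c` begins a
descent, this suffix has one descent too many for its length. -/
theorem SortsTo.length_le_of_tight {L R A B L' R' A' B' : List ℕ} (hA : SortsTo L A)
    (hB : SortsTo R B) (hA' : SortsTo L' A') (hB' : SortsTo R' B') (e : A ++ B = A' ++ B')
    (hn : (A ++ B).Nodup) (h : (A ++ B).length = 2 * descCount 0 (A ++ B)) :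
    A'.length ≤ A.length := by
  rcases eq_or_ne (A ++ B) [] with h0 | h0
  · rw [h0] at e; simp [(List.append_eq_nil_iff.1 e.symm).1]
  by_contra hlt
  push Not at hlt
  obtain ⟨-, -, -, -, -, -, -, -, hBt⟩ := hA.tight_split hB hn h h0
  obtain ⟨C', c, b, B₁, h1, h2, hcb, hA't, hB't⟩ :=
    hA'.tight_split hB' (e ▸ hn) (e ▸ h) (e ▸ h0)
  obtain ⟨C, hC, hBC⟩ : ∃ C, A' = A ++ C ∧ B = C ++ B' := by
    rcases List.append_eq_append_iff.1 e with ⟨C, h1, h2⟩ | ⟨C, h1, h2⟩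
    · exact ⟨C, h1, h2⟩
    · rw [h1] at hlt; simp at hlt
  rcases List.eq_nil_or_concat' C with rfl | ⟨C, x, rfl⟩
  · rw [hC] at hlt; simp at hlt
  rw [h1, ← List.append_assoc] at hC
  obtain rfl : c = x := by simpa using (List.append_inj' hC rfl).2
  subst hBC h2
  have := SortsTo.two_mul_descCount_lt (l := C) (r := c :: b :: B₁) (q := R) (by simpa using hB)
    (by simpa using (List.nodup_append.1 hn).2.1) (by simp)
  simp only [descCount, hcb, List.length_cons] at this hB't
  simp at this
  omega

theorem SortsTo.unique {q p : List ℕ} (h : SortsTo q p) (hn : p.Nodup)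
    (ht : p.length = 2 * descCount 0 p + 1) : ∀ q', SortsTo q' p → q' = q := by
  induction h with
  | nil => simp at ht
  | @node L R A B m hL hR hA hB ihA ihB =>
    intro q' h'
    have hm : ∀ x ∈ A ++ B, x < m := fun x hx => (List.mem_append.1 hx).elim
      (fun h => hL x (hA.perm.mem_iff.2 h)) fun h => hR x (hB.perm.mem_iff.2 h)
    obtain ⟨L', R', A', B', m', rfl, e', hL', hR', hA', hB'⟩ := h'.inv (by simp)
    obtain ⟨e, hx⟩ := List.append_inj' e' rfl
    obtain rfl : m = m' := by simpa using hx
    have hnAB := (List.nodup_append.1 hn).1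
    rw [descCount_concat 0 m _ hm, List.length_append] at ht
    simp only [List.length_singleton, Nat.add_right_cancel_iff] at ht
    have hl := le_antisymm (hA'.length_le_of_tight hB' hA hB e.symm (e ▸ hnAB) (e ▸ ht))
      (hA.length_le_of_tight hB hA' hB' e hnAB ht)
    obtain ⟨rfl, rfl⟩ := List.append_inj e hl
    rcases eq_or_ne (A ++ B) [] with h0 | h0
    · obtain ⟨rfl, rfl⟩ := List.append_eq_nil_iff.1 h0
      rw [List.perm_nil.1 hA.perm, List.perm_nil.1 hA'.perm, List.perm_nil.1 hB.perm,
        List.perm_nil.1 hB'.perm]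
    · obtain ⟨-, -, -, -, -, -, -, h1, h2⟩ := hA.tight_split hB hnAB ht h0
      rw [ihA (List.nodup_append.1 hnAB).1 h1 _ hA', ihB (List.nodup_append.1 hnAB).2.1 h2 _ hB']

/-- A sorted word of smaller letters can be attached in front of the output of the stack. -/
theorem SortsTo.attach {L A R P : List ℕ} (hA : SortsTo L A) (hR : SortsTo R P) {x : ℕ}
    {B : List ℕ} (hP : P = x :: B) (hx : ∀ a ∈ A, a < x) : ∃ R', SortsTo R' (A ++ P) := by
  induction hR generalizing x B with
  | nil => simp at hP
  | @node R₁ R₂ P₁ P₂ m h₁ h₂ hP₁ hP₂ ih₁ ih₂ =>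
    have hxm : x ≤ m := by
      have : x ∈ P₁ ++ P₂ ++ [m] := by rw [hP]; simp
      simp only [List.mem_append, List.mem_singleton] at this
      rcases this with (h | h) | h
      · exact (h₁ x (hP₁.perm.mem_iff.2 h)).le
      · exact (h₂ x (hP₂.perm.mem_iff.2 h)).le
      · exact h.le
    have hAm : ∀ a ∈ A, a < m := fun a ha => (hx a ha).trans_le hxm
    have aux : ∀ {R' Q P : List ℕ}, SortsTo R' Q → (∀ v ∈ Q, v ∈ A ∨ v ∈ P) →
        (∀ v ∈ P, v < m) → ∀ v ∈ R', v < m := by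
      intro R' Q P h h' h'' v hv
      rcases h' v (h.perm.mem_iff.1 hv) with h | h
      exacts [hAm v h, h'' v h]
    -- The recursion follows the first output letter `x`: it lies in `P₁`, or in `P₂` if `P₁` is
    -- empty, or is `m` itself. In the last case `L` becomes the part to the left of `m`.
    rcases P₁ with - | ⟨y, P₁⟩
    · rcases P₂ with - | ⟨y, P₂⟩
      · refine ⟨L ++ m :: [], ?_⟩
        have := SortsTo.node (m := m) (fun v hv => hAm v (hA.perm.mem_iff.1 hv))
          (by simp) hA SortsTo.nil
        simpa using this
      · obtain ⟨R', hR'⟩ := ih₂ (x := x) (B := P₂) (by simp at hP; simp [hP.1]) hx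
        have hR'm := aux hR' (fun v hv => List.mem_append.1 hv)
          fun v hv => h₂ v (hP₂.perm.mem_iff.2 hv)
        exact ⟨[] ++ m :: R', by simpa using SortsTo.node (by simp) hR'm SortsTo.nil hR'⟩
    · obtain ⟨R', hR'⟩ := ih₁ (x := x) (B := P₁) (by simp at hP; simp [hP.1]) hx
      have hR'm := aux hR' (fun v hv => List.mem_append.1 hv)
        fun v hv => h₁ v (hP₁.perm.mem_iff.2 hv)
      exact ⟨R' ++ m :: R₂, by simpa using SortsTo.node hR'm h₂ hR' hP₂⟩

theorem append_cons_ne_cons {L R R' : List ℕ} {m : ℕ} (hL : ∀ x ∈ L, x < m) (h0 : L ≠ []) :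
    m :: R' ≠ L ++ m :: R := by
  obtain ⟨a, L, rfl⟩ := List.exists_cons_of_ne_nil h0
  intro h
  have := hL a (by simp)
  simp only [List.cons_append, List.cons.injEq] at h
  omega

/-- If one of `A`, `B` is empty, the other factor can move across `m`. If one of them is not tight,
it has another preimage by induction. Otherwise the missing descent is the one at the junction, so
every letter of `A` is smaller than the first letter of `B`, and `SortsTo.attach` yields a preimage
with nothing to the left of `m`. -/
theorem SortsTo.exists_ne {q p : List ℕ} (h : SortsTo q p) (hn : p.Nodup) (h0 : p ≠ [])
    (ht : p.length ≠ 2 * descCount 0 p + 1) : ∃ q', SortsTo q' p ∧ q' ≠ q := by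
  induction h with
  | nil => exact absurd rfl h0
  | @node L R A B m hL hR hA hB ihA ihB =>
    have hLA : ∀ x ∈ A, x < m := fun x hx => hL x (hA.perm.mem_iff.2 hx)
    have hm : ∀ x ∈ A ++ B, x < m := fun x hx => (List.mem_append.1 hx).elim
      (hLA x) fun h => hR x (hB.perm.mem_iff.2 h)
    have hnAB := (List.nodup_append.1 hn).1
    have hnA := (List.nodup_append.1 hnAB).1
    have hnB := (List.nodup_append.1 hnAB).2.1
    rw [descCount_concat 0 m _ hm, List.length_append, List.length_singleton] at ht
    rcases eq_or_ne A [] with rfl | hA0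
    · have hL0 : L = [] := List.perm_nil.1 hA.perm
      subst hL0
      rcases eq_or_ne B [] with rfl | hB0
      · simp [descCount] at ht
      · have hR0 : R ≠ [] := fun h => hB0 (List.nil_perm.1 (h ▸ hB.perm))
        refine ⟨R ++ m :: [], by simpa using SortsTo.node hR (by simp) hB SortsTo.nil, ?_⟩
        exact (append_cons_ne_cons hR hR0).symm
    have hL0 : L ≠ [] := fun h => hA0 (List.nil_perm.1 (h ▸ hA.perm))
    rcases eq_or_ne B [] with rfl | hB0
    · have hR0 : R = [] := List.perm_nil.1 hB.perm
      subst hR0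
      exact ⟨m :: L, by simpa using SortsTo.node (by simp) hL SortsTo.nil hA,
        append_cons_ne_cons hL hL0⟩
    by_cases hAt : A.length = 2 * descCount 0 A + 1
    swap
    · obtain ⟨L', hL', hne⟩ := ihA hnA hA0 hAt
      exact ⟨L' ++ m :: R, .node (fun x hx => hLA x (hL'.perm.mem_iff.1 hx)) hR hL' hB,
        fun h => hne (List.append_cancel_right h)⟩
    by_cases hBt : B.length = 2 * descCount 0 B + 1
    swap
    · obtain ⟨R', hR', hne⟩ := ihB hnB hB0 hBt
      exact ⟨L ++ m :: R', .node hL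
        (fun x hx => hR x (hB.perm.mem_iff.2 (hR'.perm.mem_iff.1 hx))) hA hR',
        fun h => hne (by simpa using h)⟩
    obtain ⟨A', a, rfl, ha⟩ := hA.exists_max hA0
    obtain ⟨b, B, rfl⟩ := List.exists_cons_of_ne_nil hB0
    rw [descCount_append, List.length_append] at ht
    have hab : a < b := by
      by_contra hc
      have hne : a ≠ b := (List.nodup_append.1 hnAB).2.2 a (by simp) b (by simp)
      rw [if_pos ⟨by omega, by omega⟩] at ht
      omega
    obtain ⟨R', hR'⟩ := hA.attach hB rfl (x := b) (B := B) (by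
      intro x hx
      rcases List.mem_append.1 hx with hx | hx
      · exact (ha x hx).trans hab
      · rw [List.mem_singleton.1 hx]; exact hab)
    refine ⟨m :: R', ?_, append_cons_ne_cons hL hL0⟩
    simpa using SortsTo.node (by simp) (fun x hx => hm x (hR'.perm.mem_iff.1 hx)) SortsTo.nil hR'

/-- A nonempty permutation is uniquely sorted iff it is sorted and the number of its descents is
the largest possible for a sorted permutation of its length. -/
theorem fertility_eq_one_iff_tight {p : List ℕ} (hp : IsPermWord p) (h0 : p ≠ []) :
    fertility p = 1 ↔ (∃ q, SortsTo q p) ∧ p.length = 2 * descCount 0 p + 1 := by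
  rw [fertility_eq_one_iff hp]
  constructor
  · rintro ⟨q, hq, hu⟩
    refine ⟨⟨q, hq⟩, ?_⟩
    by_contra hc
    obtain ⟨q', hq', hne⟩ := hq.exists_ne hp.1 h0 hc
    exact hne (hu q' hq')
  · rintro ⟨⟨q, hq⟩, ht⟩
    exact ⟨q, hq, hq.unique hp.1 ht⟩

/-! ### Patterns of length three -/

theorem triplewise_iff_forall_sublist {α : Type*} {P : α → α → α → Prop} {l : List α} :
    l.Triplewise P ↔ ∀ a b c, [a, b, c].Sublist l → P a b c := by
  induction l with
  | nil => simp
  | cons x l ih =>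
    rw [List.triplewise_cons, ih, List.pairwise_iff_forall_sublist]
    constructor
    · rintro ⟨h1, h2⟩ a b c h
      cases h with
      | cons _ h => exact h2 _ _ _ h
      | cons_cons _ h => exact h1 h
    · intro h
      exact ⟨fun h' => h _ _ _ (h'.cons_cons x), fun a b c h' => h _ _ _ (h'.cons x)⟩

theorem exists_sublist_of_containsPattern {p : List ℕ} {x y z : ℕ}
    (h : ContainsPattern p [x, y, z]) :
    ∃ a b c, [a, b, c].Sublist p ∧ normalize [a, b, c] = normalize [x, y, z] := by
  obtain ⟨q, hq, e⟩ := h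
  have hl : q.length = 3 := by simpa [normalize] using congrArg List.length e
  obtain ⟨a, b, c, rfl⟩ := List.length_eq_three.1 hl
  exact ⟨a, b, c, hq, e⟩

theorem normalize_eq_132 {a b c : ℕ} :
    normalize [a, b, c] = normalize [1, 3, 2] ↔ a < c ∧ c < b := by
  simp only [normalize, List.map, List.countP_cons, List.countP_nil, decide_eq_true_eq,
    List.cons.injEq, and_true]
  norm_num
  grind

theorem normalize_eq_231 {a b c : ℕ} :
    normalize [a, b, c] = normalize [2, 3, 1] ↔ c < a ∧ a < b := by
  simp only [normalize, List.map, List.countP_cons, List.countP_nil, decide_eq_true_eq,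
    List.cons.injEq, and_true]
  norm_num
  grind

theorem normalize_eq_312 {a b c : ℕ} :
    normalize [a, b, c] = normalize [3, 1, 2] ↔ b < c ∧ c < a := by
  simp only [normalize, List.map, List.countP_cons, List.countP_nil, decide_eq_true_eq,
    List.cons.injEq, and_true]
  norm_num
  grind

theorem not_containsPattern_312 {p : List ℕ}
    (h : p.Triplewise fun a b c => ¬(b < c ∧ c < a)) : ¬ContainsPattern p [3, 1, 2] := by
  intro hc
  obtain ⟨a, b, c, hs, e⟩ := exists_sublist_of_containsPattern hc
  exact triplewise_iff_forall_sublist.1 h a b c hs (normalize_eq_312.1 e)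

/-- The outer letters of a triple are distinct, so the two patterns together are the two kinds of
triple with its peak in the middle. -/
theorem avoids_132_231_iff {p : List ℕ} (hp : p.Nodup) :
    (∀ t ∈ ({[1, 3, 2], [2, 3, 1]} : Set (List ℕ)), ¬ContainsPattern p t) ↔
      p.Triplewise fun a b c => ¬(a < b ∧ c < b) := by
  simp only [Set.mem_insert_iff, Set.mem_singleton_iff, forall_eq_or_imp, forall_eq]
  rw [triplewise_iff_forall_sublist]
  constructor
  · rintro ⟨h1, h2⟩ a b c hs ⟨hab, hcb⟩
    have hne : a ≠ c := by
      have := hs.nodup hp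
      simp at this; tauto
    rcases lt_or_gt_of_ne hne with h | h
    · exact h1 ⟨_, hs, normalize_eq_132.2 ⟨h, hcb⟩⟩
    · exact h2 ⟨_, hs, normalize_eq_231.2 ⟨h, hab⟩⟩
  · intro h
    constructor
    · intro hc
      obtain ⟨a, b, c, hs, e⟩ := exists_sublist_of_containsPattern hc
      have := normalize_eq_132.1 e
      exact h a b c hs ⟨by omega, by omega⟩
    · intro hc
      obtain ⟨a, b, c, hs, e⟩ := exists_sublist_of_containsPattern hc
      have := normalize_eq_231.1 e
      exact h a b c hs ⟨by omega, by omega⟩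

/-! ### The orderings of `1, …, n` -/

theorem S.nodup {n : ℕ} {p : List ℕ} (h : p ∈ S n) : p.Nodup :=
  (List.Perm.nodup_iff h).2 List.nodup_range'

theorem S.length {n : ℕ} {p : List ℕ} (h : p ∈ S n) : p.length = n := by
  simpa using List.Perm.length_eq h

theorem S.mem_iff {n : ℕ} {p : List ℕ} (h : p ∈ S n) {v : ℕ} : v ∈ p ↔ 1 ≤ v ∧ v ≤ n := by
  rw [List.Perm.mem_iff h, List.mem_range'_1]; omega

theorem S.isPermWord {n : ℕ} {p : List ℕ} (h : p ∈ S n) : IsPermWord p :=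
  ⟨S.nodup h, fun _ hv => ((S.mem_iff h).1 hv).1⟩

theorem mem_S_of {n : ℕ} {p : List ℕ} (hn : p.Nodup) (hl : p.length = n)
    (h : ∀ v ∈ p, 1 ≤ v ∧ v ≤ n) : p ∈ S n := by
  refine (hn.subperm fun v hv => ?_).perm_of_length_le (by simp [hl])
  rw [List.mem_range'_1]
  have := h v hv
  omega

theorem S.concat_perm (n : ℕ) {p : List ℕ} (h : p ∈ S n) : p ++ [n + 1] ∈ S (n + 1) := by
  change List.Perm _ _
  rw [List.range'_concat, Nat.one_mul, Nat.add_comm 1 n]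
  exact List.Perm.append_right _ h

/-! ### The word of descents -/

/-- The word with a letter `U` for each descent and a letter `D` for each ascent. -/
def stepWord : List ℕ → List DyckStep
  | [] => []
  | [_] => []
  | a :: b :: l => (if b < a then DyckStep.U else DyckStep.D) :: stepWord (b :: l)

@[simp] theorem length_stepWord (r : List ℕ) : (stepWord r).length = r.length - 1 := by
  induction r with
  | nil => rfl
  | cons a l ih => cases l <;> simp_all [stepWord]

theorem stepWord_append (a b : ℕ) (l r : List ℕ) :
    stepWord (l ++ [a] ++ b :: r) =
      stepWord (l ++ [a]) ++ (if b < a then DyckStep.U else DyckStep.D) :: stepWord (b :: r) := by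
  induction l with
  | nil => simp [stepWord]
  | cons c l ih =>
    cases l with
    | nil => simp [stepWord]
    | cons d l =>
      simp only [List.cons_append] at ih
      simp only [List.cons_append, stepWord, ih]

theorem stepWord_map_succ (l : List ℕ) : stepWord (l.map (· + 1)) = stepWord l := by
  induction l with
  | nil => rfl
  | cons a l ih =>
    cases l with
    | nil => rfl
    | cons b l => simpa [stepWord] using ih

theorem getElem_stepWord (r : List ℕ) (i : ℕ) (h : i < (stepWord r).length) :
    (stepWord r)[i] = if r.getD (i + 1) 0 < r.getD i 0 then DyckStep.U else DyckStep.D := by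
  induction r generalizing i with
  | nil => simp [stepWord] at h
  | cons a l ih =>
    cases l with
    | nil => simp [stepWord] at h
    | cons b l =>
      cases i with
      | zero => simp [stepWord]
      | succ i =>
        simp only [stepWord, List.getElem_cons_succ]
        rw [ih]
        simp

theorem count_stepWord_reverse (p : List ℕ) (hp : p.Nodup) :
    (stepWord p.reverse).count DyckStep.D = descCount 0 p ∧
      (stepWord p.reverse).count DyckStep.U = ascCount 0 p := by
  induction p with
  | nil => simp [stepWord, descCount, ascCount]
  | cons a l ih =>
    cases l with
    | nil => simp [stepWord, descCount, ascCount]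
    | cons b l =>
      obtain ⟨h1, h2⟩ := ih (List.nodup_cons.1 hp).2
      have hab : a ≠ b := fun h => (List.nodup_cons.1 hp).1 (by simp [h])
      have e : (a :: b :: l).reverse = l.reverse ++ [b] ++ a :: [] := by simp
      rw [e, stepWord_append, ← List.reverse_cons, List.count_append, List.count_append, h1, h2]
      rcases lt_or_gt_of_ne hab with h | h
      · simp [h, not_lt.2 h.le, stepWord, descCount, ascCount, Nat.add_comm]
      · simp [h, not_lt.2 h.le, stepWord, descCount, ascCount, Nat.add_comm]

theorem map_mem_Des (r : List ℕ) (n : ℕ) (hr : r.length = n + 1) :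
    ((List.range' 1 n).map fun i => if i ∈ Des r then DyckStep.U else DyckStep.D) = stepWord r := by
  apply List.ext_getElem
  · simp [hr]
  · intro i h1 h2
    rw [getElem_stepWord]
    simp only [List.length_map, List.length_range'] at h1
    simp only [List.getElem_map, List.getElem_range', Des, Finset.mem_filter, Finset.mem_Ico]
    have e1 : 1 + 1 * i - 1 = i := by omega
    have e2 : 1 + 1 * i = i + 1 := by omega
    rw [e1, e2]
    have : 1 ≤ i + 1 ∧ i + 1 < r.length := by omega
    simp [this]

/-- Reversal exchanges descents with ascents and index `i` with `n + 1 - i`; hence the letters trade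
places. -/
theorem map_sub_mem_Des (p : List ℕ) (hp : p.Nodup) (n : ℕ) (hl : p.length = n + 1) :
    ((List.range' 1 n).map fun i => if n + 1 - i ∈ Des p then DyckStep.D else DyckStep.U) =
      stepWord p.reverse := by
  apply List.ext_getElem
  · simp [hl]
  · intro i h1 h2
    rw [getElem_stepWord]
    simp only [List.length_map, List.length_range'] at h1
    simp only [List.getElem_map, List.getElem_range', Des, Finset.mem_filter, Finset.mem_Ico]
    have e1 : n + 1 - (1 + 1 * i) = n - i := by omega
    rw [e1]
    have g1 : p.getD (n - i) 0 = p[n - i] := List.getD_eq_getElem _ _ (by omega)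
    have g2 : p.getD (n - i - 1) 0 = p[n - i - 1] := List.getD_eq_getElem _ _ (by omega)
    have g3 : p.reverse.getD i 0 = p[n - i] := by
      rw [List.getD_eq_getElem _ _ (by simp; omega), List.getElem_reverse]
      congr 1; omega
    have g4 : p.reverse.getD (i + 1) 0 = p[n - i - 1] := by
      rw [List.getD_eq_getElem _ _ (by simp; omega), List.getElem_reverse]
      congr 1; omega
    rw [g1, g2, g3, g4]
    have hne : p[n - i] ≠ p[n - i - 1] := by
      rw [Ne, hp.getElem_inj_iff]; omega
    have : 1 ≤ n - i ∧ n - i < p.length := by omega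
    simp only [this, and_self, true_and]
    rcases lt_or_gt_of_ne hne with h | h
    · simp [h, not_lt.2 h.le]
    · simp [h, not_lt.2 h.le]

theorem DL_eq (k : ℕ) (p : List ℕ) (hp : p ∈ S (2 * k + 1)) :
    DL k p = (stepWord p.reverse, stepWord (rot p)) := by
  have h1 := map_sub_mem_Des p (S.nodup hp) (2 * k) (S.length hp)
  have h2 := map_mem_Des (rot p) (2 * k) (by simp [rot, inv, S.length hp])
  rw [DL, h1, h2]

/-! ### Permutations without interior peaks -/

/-- The permutation that decreases to `1` and then increases, with `n + 1 - i` on the increasing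
side iff the `i`-th letter of the word is `U`. -/
def valley : List DyckStep → List ℕ
  | [] => [1]
  | DyckStep.U :: w => valley w ++ [w.length + 2]
  | DyckStep.D :: w => (w.length + 2) :: valley w

theorem valley_mem_S (w : List DyckStep) : valley w ∈ S (w.length + 1) := by
  induction w with
  | nil => exact List.Perm.refl _
  | cons s w ih =>
    have h := S.concat_perm _ ih
    cases s with
    | U => exact h
    | D => exact (List.perm_append_comm (l₁ := [w.length + 2])).trans h

theorem valley_ne_nil (w : List DyckStep) : valley w ≠ [] := by
  rcases w with - | ⟨- | -, w⟩ <;> simp [valley]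

theorem lt_of_mem_valley {w : List DyckStep} {v : ℕ} (h : v ∈ valley w) : v < w.length + 2 := by
  have := ((S.mem_iff (valley_mem_S w)).1 h).2
  omega

theorem triplewise_valley (w : List DyckStep) :
    (valley w).Triplewise fun a b c => ¬(a < b ∧ c < b) := by
  induction w with
  | nil => simp [valley]
  | cons s w ih =>
    cases s with
    | U =>
      simp only [valley, List.triplewise_append, ih, List.triplewise_singleton,
        List.pairwise_singleton, implies_true, true_and, List.mem_singleton, forall_eq]
      refine List.pairwise_of_forall_mem_list fun a ha b hb => ?_
      have := lt_of_mem_valley hb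
      omega
    | D =>
      simp only [valley, List.triplewise_cons, ih, and_true]
      refine List.pairwise_of_forall_mem_list fun a ha b hb => ?_
      have := lt_of_mem_valley ha
      omega

/-- The largest letter stands at an end, as it would otherwise be the peak of a forbidden triple;
removing it gives the first letter of the word. -/
theorem exists_valley_eq (n : ℕ) (p : List ℕ) (hp : p ∈ S (n + 1))
    (h : p.Triplewise fun a b c => ¬(a < b ∧ c < b)) : ∃ w, w.length = n ∧ valley w = p := by
  induction n generalizing p with
  | zero => exact ⟨[], rfl, (List.perm_singleton.1 hp).symm⟩
  | succ n ih =>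
    obtain ⟨l, r, rfl⟩ := List.append_of_mem ((S.mem_iff hp).2 ⟨by omega, le_refl (n + 1 + 1)⟩)
    have hlt : ∀ v ∈ l ++ r, v < n + 2 := by
      intro v hv
      have h1 := (S.mem_iff hp (v := v)).1 (by simp at hv ⊢; tauto)
      have h2 := S.nodup hp
      have : v ≠ n + 2 := by
        rintro rfl
        exact (List.nodup_cons.1 (List.nodup_middle.1 h2)).1 hv
      omega
    have hS : l ++ r ∈ S (n + 1) := by
      have h2 := (List.nodup_cons.1 (List.nodup_middle.1 (S.nodup hp))).2
      refine mem_S_of h2 ?_ fun v hv => ?_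
      · have := S.length hp
        simp at this ⊢; omega
      · have h1 := (S.mem_iff hp (v := v)).1 (by simp at hv ⊢; tauto)
        have := hlt v hv
        omega
    rcases List.eq_nil_or_concat' l with rfl | ⟨l, a, rfl⟩
    · obtain ⟨w, rfl, rfl⟩ := ih r hS (List.triplewise_cons.1 h).2
      exact ⟨DyckStep.D :: w, rfl, rfl⟩
    · rcases r with - | ⟨b, r⟩
      · obtain ⟨w, rfl, hw⟩ := ih _ hS (by simpa using (List.triplewise_append.1 h).1)
        exact ⟨DyckStep.U :: w, rfl, by rw [valley, hw]; simp⟩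
      · exfalso
        refine triplewise_iff_forall_sublist.1 h a (n + 1 + 1) b ?_
          ⟨hlt a (by simp), hlt b (by simp)⟩
        simp

/-! ### Rotations of valley permutations -/

theorem inv_concat {n : ℕ} {p : List ℕ} (h : p ∈ S n) : inv (p ++ [n + 1]) = inv p ++ [n + 1] := by
  have hl := S.length h
  simp only [inv, List.length_append, List.length_singleton, List.range'_concat, List.map_append,
    List.map_cons, List.map_nil, hl]
  congr 1
  · refine List.map_congr_left fun v hv => ?_
    rw [List.idxOf_append_of_mem ((List.Perm.mem_iff h).2 hv)]
  · rw [List.idxOf_append_of_notMem]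
    · simp [hl, Nat.add_comm]
    · rw [S.mem_iff h]; omega

theorem inv_cons {n : ℕ} {p : List ℕ} (h : p ∈ S n) :
    inv ((n + 1) :: p) = (inv p).map (· + 1) ++ [1] := by
  have hl := S.length h
  simp only [inv, List.length_cons, List.range'_concat, List.map_append,
    List.map_cons, List.map_nil, hl, List.map_map]
  congr 1
  · refine List.map_congr_left fun v hv => ?_
    have : n + 1 ≠ v := by
      rw [List.mem_range'_1] at hv; omega
    simp [List.idxOf_cons_ne _ this]
  · simp [Nat.add_comm]

theorem rot_concat {n : ℕ} {p : List ℕ} (h : p ∈ S n) : rot (p ++ [n + 1]) = (n + 1) :: rot p := by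
  simp [rot, inv_concat h]

theorem rot_cons {n : ℕ} {p : List ℕ} (h : p ∈ S n) :
    rot ((n + 1) :: p) = 1 :: (rot p).map (· + 1) := by
  simp [rot, inv_cons h]

theorem mem_rot_bounds {n : ℕ} {p : List ℕ} (h : p ∈ S n) {v : ℕ} (hv : v ∈ rot p) :
    1 ≤ v ∧ v ≤ n := by
  simp only [rot, inv, List.mem_reverse, List.mem_map] at hv
  obtain ⟨u, hu, rfl⟩ := hv
  rw [S.length h] at hu
  have := List.idxOf_lt_length_of_mem ((List.Perm.mem_iff h).2 hu)
  rw [S.length h] at this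
  omega

theorem stepWord_rot_valley (w : List DyckStep) : stepWord (rot (valley w)) = w := by
  induction w with
  | nil => rfl
  | cons s w ih =>
    have hS := valley_mem_S w
    have hl : (rot (valley w)).length = w.length + 1 := by simp [rot, inv, S.length hS]
    have hb : ∀ v ∈ rot (valley w), _ := fun v hv => mem_rot_bounds hS hv
    cases s with
    | U =>
      rw [valley, rot_concat hS]
      generalize rot (valley w) = r at *
      rcases r with - | ⟨a, r⟩
      · simp at hl
      · have := hb a (by simp)
        rw [stepWord, ih, if_pos (by omega)]
    | D =>
      rw [valley, rot_cons hS]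
      generalize rot (valley w) = r at *
      rcases r with - | ⟨a, r⟩
      · simp at hl
      · have := hb a (by simp)
        rw [List.map_cons, stepWord, if_neg (by omega), ← List.map_cons (f := (· + 1)),
          stepWord_map_succ, ih]

/-- The rotation is built by prepending a new largest or a new smallest letter, and neither can play
the 2 in a pattern 213. -/
theorem triplewise_rot_valley (w : List DyckStep) :
    (rot (valley w)).Triplewise fun a b c => ¬(b < a ∧ a < c) := by
  induction w with
  | nil => simp [valley, rot, inv]
  | cons s w ih =>
    have hS := valley_mem_S w
    have hb : ∀ v ∈ rot (valley w), _ := fun v hv => mem_rot_bounds hS hv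
    cases s with
    | U =>
      rw [valley, rot_concat hS, List.triplewise_cons]
      refine ⟨List.pairwise_of_forall_mem_list fun a ha b hb' => ?_, ih⟩
      have := hb b hb'
      omega
    | D =>
      rw [valley, rot_cons hS, List.triplewise_cons]
      refine ⟨List.pairwise_of_forall_mem_list fun a ha b hb' => ?_, ?_⟩
      · obtain ⟨a, -, rfl⟩ := List.mem_map.1 ha
        omega
      · rw [List.triplewise_map]
        simpa using ih

/-! ### Unique sortedness of valley permutations -/

/-- The letters of `valley v` go up to `v.length + 1`, so the threshold selects the letters placed
by `u`. Each `D` places the top of a descent, each `U` the top of an ascent. -/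
theorem count_valley (u v : List DyckStep) :
    descCount (v.length + 2) (valley (u ++ v)) = u.count DyckStep.D ∧
      ascCount (v.length + 2) (valley (u ++ v)) = u.count DyckStep.U := by
  induction u with
  | nil =>
    have : ∀ p : List ℕ, (∀ x ∈ p, x < v.length + 2) →
        descCount (v.length + 2) p = 0 ∧ ascCount (v.length + 2) p = 0 := by
      intro p
      induction p with
      | nil => simp [descCount, ascCount]
      | cons a l ih =>
        intro h
        cases l with
        | nil => simp [descCount, ascCount]
        | cons b l =>
          have h1 := h a (by simp)
          have h2 := h b (by simp)
          have h3 := ih fun x hx => h x (List.mem_cons_of_mem _ hx)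
          simp only [descCount, ascCount, h3]
          simp
          omega
    simpa using this (valley v) fun x hx => lt_of_mem_valley hx
  | cons s u ih =>
    have hlt : ∀ x ∈ valley (u ++ v), x < (u ++ v).length + 2 := fun x hx => lt_of_mem_valley hx
    have hne := valley_ne_nil (u ++ v)
    have hle : v.length + 2 ≤ (u ++ v).length + 2 := by simp
    cases s with
    | U =>
      rw [List.cons_append, valley, descCount_concat _ _ _ hlt, ascCount_concat _ _ _ hlt hne, ih.1,
        ih.2, if_pos hle]
      simp
    | D =>
      rw [List.cons_append, valley]
      generalize valley (u ++ v) = p at *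
      obtain ⟨a, p, rfl⟩ := List.exists_cons_of_ne_nil hne
      have := hlt a (by simp)
      rw [descCount, ascCount, if_pos ⟨this, hle⟩, if_neg (by omega), ih.1, ih.2]
      simp [Nat.add_comm]

theorem exists_sortsTo_of_increasing (l : List ℕ) (h : l.Pairwise (· < ·)) :
    ∃ q, SortsTo q l := by
  induction l using List.reverseRecOn with
  | nil => exact ⟨_, .nil⟩
  | append_singleton l m ih =>
    rw [List.pairwise_append] at h
    obtain ⟨q, hq⟩ := ih h.1
    have hm : ∀ x ∈ l, x < m := fun x hx => h.2.2 x hx m (by simp)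
    exact ⟨q ++ m :: [], by
      simpa using SortsTo.node (fun x hx => hm x (hq.perm.mem_iff.1 hx)) (by simp) hq .nil⟩

/-- The condition at the largest letter `d` of `ds` makes the last letter `x` of `as` exceed it. A
preimage is `d`, `x`, then a preimage of what remains after deleting both. The condition survives:
below or at `d` both counts drop by one, and above `d` no letter of `ds` is left. -/
theorem exists_sortsTo_of_ballot (m : ℕ) (ds as : List ℕ) (hds : ds.Pairwise (· > ·))
    (has : as.Pairwise (· < ·)) (hdm : ∀ x ∈ ds, m < x) (ham : ∀ x ∈ as, m < x)
    (hda : ∀ x ∈ ds, x ∉ as)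
    (h : ∀ t, ds.countP (fun x => t ≤ x) ≤ as.countP (fun x => t ≤ x)) :
    ∃ q, SortsTo q (ds ++ m :: as) := by
  induction ds generalizing as with
  | nil => exact exists_sortsTo_of_increasing _ (List.pairwise_cons.2 ⟨ham, has⟩)
  | cons d ds ih =>
    rw [List.pairwise_cons] at hds
    obtain ⟨y, hy, hdy⟩ : ∃ y ∈ as, d ≤ y := by
      have := h d
      rw [List.countP_cons_of_pos (by simp)] at this
      have : 0 < as.countP (fun x => d ≤ x) := by omega
      simpa using List.countP_pos_iff.1 this
    rcases List.eq_nil_or_concat' as with rfl | ⟨as, x, rfl⟩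
    · simp at hy
    rw [List.pairwise_append] at has
    have hx : ∀ y ∈ as, y < x := fun y hy => has.2.2 y hy x (by simp)
    have hdx : d < x := by
      have h1 : d ≠ x := fun e => hda d (by simp) (by simp [e])
      rcases List.mem_append.1 hy with hy | hy
      · have := hx y hy; omega
      · rw [List.mem_singleton.1 hy] at hdy; omega
    have hds' : ∀ y ∈ ds, y < x := fun y hy => (hds.1 y hy).trans hdx
    obtain ⟨q, hq⟩ := ih as hds.2 has.1 (fun y hy => hdm y (by simp [hy]))
      (fun y hy => ham y (by simp [hy])) (fun y hy hy' => hda y (by simp [hy]) (by simp [hy'])) (by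
        intro t
        rcases le_or_gt t d with ht | ht
        · have := h t
          rw [List.countP_cons_of_pos (by simpa using ht), List.countP_append,
            List.countP_singleton, if_pos (by simp; omega)] at this
          omega
        · rw [List.countP_eq_zero.2]
          · exact Nat.zero_le _
          · intro y hy
            have := hds.1 y hy
            simp; omega)
    have hm := ham x (by simp)
    refine ⟨[d] ++ x :: q, ?_⟩
    have := SortsTo.node (L := [d]) (A := [d]) (m := x) (by simpa using hdx) (fun y hy => ?_)
      (by simpa using SortsTo.node (m := d) (by simp) (by simp) SortsTo.nil SortsTo.nil) hq
    · simpa using this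
    · have := hq.perm.mem_iff.1 hy
      simp only [List.mem_append, List.mem_cons] at this
      rcases this with h | h | h
      · exact hds' y h
      · rw [h]; exact hm
      · exact hx y h

/-- Letters are placed in decreasing order along the word, so those at least `t` are the ones placed
by some prefix. This turns a condition on thresholds into one on prefixes. -/
theorem exists_valley_eq_append (w : List DyckStep) : ∃ ds as, valley w = ds ++ 1 :: as ∧
    ds.Pairwise (· > ·) ∧ as.Pairwise (· < ·) ∧ (∀ x ∈ ds, 1 < x) ∧ (∀ x ∈ as, 1 < x) ∧
    ∀ t, ∃ i, ds.countP (fun x => t ≤ x) = (w.take i).count DyckStep.D ∧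
      as.countP (fun x => t ≤ x) = (w.take i).count DyckStep.U := by
  induction w with
  | nil => exact ⟨[], [], by simp [valley]⟩
  | cons s w ih =>
    obtain ⟨ds, as, e, hds, has, hd1, ha1, ht⟩ := ih
    have hdlt : ∀ x ∈ ds, x < w.length + 2 := fun x hx => lt_of_mem_valley (by rw [e]; simp [hx])
    have halt : ∀ x ∈ as, x < w.length + 2 := fun x hx => lt_of_mem_valley (by rw [e]; simp [hx])
    have hz : ∀ t, w.length + 2 < t → ds.countP (fun x => t ≤ x) = 0 ∧
        as.countP (fun x => t ≤ x) = 0 := by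
      intro t ht
      simp only [List.countP_eq_zero]
      refine ⟨fun x hx => ?_, fun x hx => ?_⟩
      · have := hdlt x hx
        simp; omega
      · have := halt x hx
        simp; omega
    cases s with
    | U =>
      refine ⟨ds, as ++ [w.length + 2], by simp [valley, e], hds, ?_, hd1, ?_, fun t => ?_⟩
      · simpa [List.pairwise_append, has] using halt
      · intro x hx
        rcases List.mem_append.1 hx with hx | hx
        · exact ha1 x hx
        · rw [List.mem_singleton.1 hx]; omega
      · rcases le_or_gt t (w.length + 2) with h | h
        · obtain ⟨i, h1, h2⟩ := ht t
          exact ⟨i + 1, by simp [h1], by simp [h2, h]⟩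
        · exact ⟨0, by simp [hz t h], by simp [hz t h, h]⟩
    | D =>
      refine ⟨(w.length + 2) :: ds, as, by simp [valley, e], ?_, has, ?_, ha1, fun t => ?_⟩
      · exact List.pairwise_cons.2 ⟨hdlt, hds⟩
      · intro x hx
        rcases List.mem_cons.1 hx with rfl | hx
        · omega
        · exact hd1 x hx
      · rcases le_or_gt t (w.length + 2) with h | h
        · obtain ⟨i, h1, h2⟩ := ht t
          exact ⟨i + 1, by simp [h1, h], by simp [h2]⟩
        · exact ⟨0, by simp [hz t h, h], by simp [hz t h]⟩

theorem count_D_add_count_U (w : List DyckStep) :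
    w.count DyckStep.D + w.count DyckStep.U = w.length := by
  induction w with
  | nil => rfl
  | cons s w ih => cases s <;> simp <;> omega

theorem fertility_valley (w : List DyckStep) :
    fertility (valley w) = 1 ↔
      w.count DyckStep.U = w.count DyckStep.D ∧
        ∀ i, (w.take i).count DyckStep.D ≤ (w.take i).count DyckStep.U := by
  have hS := valley_mem_S w
  have hc : descCount 0 (valley w) = w.count DyckStep.D := by
    induction w with
    | nil => rfl
    | cons s w ih =>
      have ih := ih (valley_mem_S w)
      cases s with
      | U =>
        rw [valley, descCount_concat _ _ _ fun x hx => lt_of_mem_valley hx, ih]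
        simp
      | D =>
        rw [valley, List.count_cons_self, ← ih]
        have hlt : ∀ x ∈ valley w, x < w.length + 2 := fun x hx => lt_of_mem_valley hx
        have hne := valley_ne_nil w
        generalize valley w = p at *
        obtain ⟨a, p, rfl⟩ := List.exists_cons_of_ne_nil hne
        rw [descCount, if_pos ⟨hlt a (by simp), by omega⟩, Nat.add_comm]
  rw [fertility_eq_one_iff_tight (S.isPermWord hS) (valley_ne_nil w), S.length hS, hc]
  have htot := count_D_add_count_U w
  constructor
  · rintro ⟨⟨q, hq⟩, h⟩
    -- The prefix inequality is the descent bound for sorted words with the threshold chosen so that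
    -- only the letters placed by the prefix count.
    refine ⟨by omega, fun i => ?_⟩
    have h1 := hq.descCount_le_ascCount ((w.drop i).length + 2) [] _ rfl
    have h2 := count_valley (w.take i) (w.drop i)
    rw [List.take_append_drop] at h2
    rw [← h2.1, ← h2.2]
    exact h1
  · rintro ⟨h, hb⟩
    refine ⟨?_, by omega⟩
    obtain ⟨ds, as, e, hds, has, hd1, ha1, ht⟩ := exists_valley_eq_append w
    rw [e]
    have hn := S.nodup hS
    rw [e, List.nodup_append] at hn
    refine exists_sortsTo_of_ballot 1 ds as hds has hd1 ha1
      (fun x hx hx' => hn.2.2 x hx x (by simp [hx']) rfl) fun t => ?_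
    obtain ⟨i, h1, h2⟩ := ht t
    rw [h1, h2]
    exact hb i

/-! ### Sorted words avoiding `231` and `312` -/

/-- If `r` avoids `132` and `213` and its word of descents is a Dyck word, then the reverse of `r`
is sorted. -/
theorem exists_sortsTo_reverse (w : DyckWord) (r : List ℕ) (hn : r.Nodup) (h0 : r ≠ [])
    (h132 : r.Triplewise fun a b c => ¬(a < c ∧ c < b))
    (h213 : r.Triplewise fun a b c => ¬(b < a ∧ a < c)) (hw : stepWord r = w.toList) :
    ∃ q, SortsTo q r.reverse := by
  induction hs : w.semilength using Nat.strong_induction_on generalizing w r with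
  | _ n ih =>
    have hlen := congrArg List.length hw
    obtain ⟨m, l, rfl⟩ := List.exists_cons_of_ne_nil h0
    simp only [length_stepWord, List.length_cons, Nat.add_sub_cancel] at hlen
    rcases eq_or_ne w 0 with rfl | hw0
    · have : l = [] := List.length_eq_zero_iff.1 hlen
      subst this
      exact ⟨[m], by simpa using SortsTo.node (m := m) (by simp) (by simp) .nil .nil⟩
    have hx := DyckWord.semilength_insidePart_lt hw0
    have hy := DyckWord.semilength_outsidePart_lt hw0
    -- The first-return decomposition `w = U x D y`.
    have hw' : w.toList = DyckStep.U :: (w.insidePart.toList ++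
        DyckStep.D :: w.outsidePart.toList) := by
      conv_lhs => rw [← DyckWord.nest_insidePart_add_outsidePart hw0]
      change ([DyckStep.U] ++ w.insidePart.toList ++ [DyckStep.D]) ++ w.outsidePart.toList = _
      simp
    generalize w.insidePart = x at *
    generalize w.outsidePart = y at *
    rw [hw'] at hlen hw
    simp only [List.length_cons, List.length_append] at hlen
    have hl0 : l ≠ [] := by rintro rfl; simp at hlen
    -- The initial `U` puts a smaller letter after `m`; avoiding 213 then leaves no larger letter
    -- anywhere behind it.
    have hlw : stepWord l = x.toList ++ DyckStep.D :: y.toList ∧ ∀ v ∈ l, v < m := by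
      obtain ⟨h, l, rfl⟩ := List.exists_cons_of_ne_nil hl0
      rw [stepWord, List.cons.injEq] at hw
      refine ⟨hw.2, fun v hv => ?_⟩
      have hh : h < m := by
        by_contra hc
        rw [if_neg hc] at hw
        simp at hw
      rcases List.mem_cons.1 hv with rfl | hv
      · exact hh
      · have h1 := (List.pairwise_cons.1 (List.triplewise_cons.1 h213).1).1 v hv
        have h2 : m ≠ v := fun e => (List.nodup_cons.1 hn).1 (by simp [e, hv])
        omega
    obtain ⟨hlw, hlm⟩ := hlw
    have hn := (List.nodup_cons.1 hn).2
    have h132 := (List.triplewise_cons.1 h132).2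
    have h213 := (List.triplewise_cons.1 h213).2
    -- The cut is at the step `D` that closes the first return. Reversed, the word reads `l₂.reverse
    -- ++ l₁.reverse ++ [m]`, the image of `q₂ ++ m :: q₁`.
    obtain ⟨l₁, l₂, rfl, hl₁, hl₂⟩ : ∃ l₁ l₂, l = l₁ ++ l₂ ∧ l₁.length = x.toList.length + 1 ∧
        l₂.length = y.toList.length + 1 := by
      refine ⟨l.take (x.toList.length + 1), l.drop (x.toList.length + 1), by simp, ?_, ?_⟩
      · rw [List.length_take]; omega
      · rw [List.length_drop]; omega
    have hl₁0 : l₁ ≠ [] := by rintro rfl; simp at hl₁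
    have hl₂0 : l₂ ≠ [] := by rintro rfl; simp at hl₂
    have hst : stepWord l₁ = x.toList ∧ stepWord l₂ = y.toList := by
      obtain ⟨b, l₂, rfl⟩ := List.exists_cons_of_ne_nil hl₂0
      rcases List.eq_nil_or_concat' l₁ with rfl | ⟨l₁, a, rfl⟩
      · exact absurd rfl hl₁0
      rw [stepWord_append] at hlw
      obtain ⟨h1, h2⟩ := List.append_inj hlw (by rw [length_stepWord, hl₁]; simp)
      exact ⟨h1, (List.cons.inj h2).2⟩
    obtain ⟨q₁, hq₁⟩ := ih _ (hs ▸ hx) x l₁ (List.nodup_append.1 hn).1 hl₁0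
      (List.triplewise_append.1 h132).1 (List.triplewise_append.1 h213).1 hst.1 rfl
    obtain ⟨q₂, hq₂⟩ := ih _ (hs ▸ hy) y l₂ (List.nodup_append.1 hn).2.1 hl₂0
      (List.triplewise_append.1 h132).2.1 (List.triplewise_append.1 h213).2.1 hst.2 rfl
    refine ⟨q₂ ++ m :: q₁, ?_⟩
    have := SortsTo.node (m := m) (fun v hv => hlm v ?_) (fun v hv => hlm v ?_) hq₂ hq₁
    · simpa using this
    · have := hq₂.perm.mem_iff.1 hv
      simp at this ⊢; tauto
    · have := hq₁.perm.mem_iff.1 hv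
      simp at this ⊢; tauto

/-! ### Entries and positions, numbered from `1` -/

/-- The `x`-th entry of a word. -/
def entry (p : List ℕ) (x : ℕ) : ℕ := p.getD (x - 1) 0

/-- The position of the letter `v`. -/
def pos (p : List ℕ) (v : ℕ) : ℕ := p.idxOf v + 1

section Entries

variable {n : ℕ} {p q : List ℕ}

theorem entry_eq_getElem {x : ℕ} (h1 : 1 ≤ x) (h2 : x ≤ p.length) :
    entry p x = p[x - 1]'(by omega) := List.getD_eq_getElem _ _ (by omega)

theorem entry_succ {i : ℕ} (h : i < p.length) : entry p (i + 1) = p[i] := by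
  rw [entry_eq_getElem (by omega) (by omega)]; rfl

theorem entry_mem_Icc (hp : p ∈ S n) {x : ℕ} (h1 : 1 ≤ x) (h2 : x ≤ n) :
    1 ≤ entry p x ∧ entry p x ≤ n := by
  rw [← S.mem_iff hp, entry_eq_getElem h1 (by rwa [S.length hp])]
  exact List.getElem_mem _

theorem pos_mem_Icc (hp : p ∈ S n) {v : ℕ} (h1 : 1 ≤ v) (h2 : v ≤ n) :
    1 ≤ pos p v ∧ pos p v ≤ n := by
  have := List.idxOf_lt_length_of_mem ((S.mem_iff hp).2 ⟨h1, h2⟩)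
  rw [S.length hp] at this
  simp only [pos]; omega

theorem pos_entry (hp : p ∈ S n) {x : ℕ} (h1 : 1 ≤ x) (h2 : x ≤ n) : pos p (entry p x) = x := by
  rw [entry_eq_getElem h1 (by rwa [S.length hp]), pos, (S.nodup hp).idxOf_getElem]
  omega

theorem entry_pos (hp : p ∈ S n) {v : ℕ} (h1 : 1 ≤ v) (h2 : v ≤ n) : entry p (pos p v) = v := by
  have := List.idxOf_lt_length_of_mem ((S.mem_iff hp).2 ⟨h1, h2⟩)
  rw [pos, entry_succ this, List.getElem_idxOf]

theorem entry_injOn (hp : p ∈ S n) {x y : ℕ} (h1 : 1 ≤ x) (h2 : x ≤ n) (h3 : 1 ≤ y) (h4 : y ≤ n)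
    (h : entry p x = entry p y) : x = y := by
  rw [← pos_entry hp h1 h2, h, pos_entry hp h3 h4]

theorem pos_injOn (hp : p ∈ S n) {x y : ℕ} (h1 : 1 ≤ x) (h2 : x ≤ n) (h3 : 1 ≤ y) (h4 : y ≤ n)
    (h : pos p x = pos p y) : x = y := by
  rw [← entry_pos hp h1 h2, h, entry_pos hp h3 h4]

theorem ext_entry (hp : p.length = n) (hq : q.length = n)
    (h : ∀ x, 1 ≤ x → x ≤ n → entry p x = entry q x) : p = q := by
  refine List.ext_getElem (hp.trans hq.symm) fun i h1 h2 => ?_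
  rw [← entry_succ, ← entry_succ]
  exact h _ (by omega) (by omega)

theorem entry_map (f : ℕ → ℕ) {x : ℕ} (h1 : 1 ≤ x) (h2 : x ≤ p.length) :
    entry (p.map f) x = f (entry p x) := by
  rw [entry_eq_getElem h1 (by simpa using h2), entry_eq_getElem h1 h2, List.getElem_map]

theorem triplewise_iff_entry {P : ℕ → ℕ → ℕ → Prop} (hp : p.length = n) :
    p.Triplewise P ↔ ∀ x y z, 1 ≤ x → x < y → y < z → z ≤ n →
      P (entry p x) (entry p y) (entry p z) := by
  rw [List.triplewise_iff_getElem]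
  constructor
  · intro h x y z h1 h2 h3 h4
    rw [entry_eq_getElem, entry_eq_getElem, entry_eq_getElem]
    · exact h _ _ _ (by omega) (by omega) (by omega)
    all_goals omega
  · intro h i j k h1 h2 h3
    have := h (i + 1) (j + 1) (k + 1) (by omega) (by omega) (by omega) (by omega)
    rwa [entry_succ, entry_succ, entry_succ] at this

theorem stepWord_eq_of_entry (hp : p.length = n) (hq : q.length = n)
    (h : ∀ x, 1 ≤ x → x < n → (entry p (x + 1) < entry p x ↔ entry q (x + 1) < entry q x)) :
    stepWord p = stepWord q := by
  refine List.ext_getElem (by simp [hp, hq]) fun i h1 h2 => ?_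
  rw [getElem_stepWord, getElem_stepWord]
  rw [length_stepWord] at h1
  have := h (i + 1) (by omega) (by omega)
  simp only [entry, Nat.add_sub_cancel] at this
  simp only [this]

theorem S.reverse (hp : p ∈ S n) : p.reverse ∈ S n := (List.reverse_perm p).trans hp

theorem entry_reverse (hp : p.length = n) {x : ℕ} (h1 : 1 ≤ x) (h2 : x ≤ n) :
    entry p.reverse x = entry p (n + 1 - x) := by
  rw [entry_eq_getElem h1 (by simp; omega), entry_eq_getElem (by omega) (by omega),
    List.getElem_reverse]
  congr 1; omega

theorem pos_reverse (hp : p ∈ S n) {v : ℕ} (h1 : 1 ≤ v) (h2 : v ≤ n) :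
    pos p.reverse v = n + 1 - pos p v := by
  have := pos_mem_Icc hp h1 h2
  have h : entry p.reverse (n + 1 - pos p v) = v := by
    rw [entry_reverse (S.length hp) (by omega) (by omega),
      show n + 1 - (n + 1 - pos p v) = pos p v by omega, entry_pos hp h1 h2]
  conv_lhs => rw [← h]
  exact pos_entry (S.reverse hp) (by omega) (by omega)

theorem entry_inv (hp : p.length = n) {x : ℕ} (h1 : 1 ≤ x) (h2 : x ≤ n) :
    entry (inv p) x = pos p x := by
  rw [entry_eq_getElem h1 (by simp [inv]; omega)]
  simp only [inv, List.getElem_map, List.getElem_range', pos]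
  congr 2; omega

theorem S.inv (hp : p ∈ S n) : inv p ∈ S n := by
  have hl := S.length hp
  refine mem_S_of ?_ (by simp [CatalanPerm.inv, hl]) fun v hv => ?_
  · refine List.Nodup.map_on ?_ List.nodup_range'
    intro x hx y hy h
    rw [List.mem_range'_1] at hx hy
    exact pos_injOn hp hx.1 (by omega) hy.1 (by omega) h
  · obtain ⟨x, hx, rfl⟩ := List.mem_map.1 hv
    rw [List.mem_range'_1] at hx
    exact pos_mem_Icc hp hx.1 (by omega)

theorem pos_inv (hp : p ∈ S n) {v : ℕ} (h1 : 1 ≤ v) (h2 : v ≤ n) :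
    pos (CatalanPerm.inv p) v = entry p v := by
  have := entry_mem_Icc hp h1 h2
  have h : entry (CatalanPerm.inv p) (entry p v) = v := by
    rw [entry_inv (S.length hp) this.1 this.2, pos_entry hp h1 h2]
  conv_lhs => rw [← h]
  exact pos_entry (S.inv hp) this.1 this.2

theorem inv_inv (hp : p ∈ S n) : CatalanPerm.inv (CatalanPerm.inv p) = p := by
  refine ext_entry (S.length (S.inv (S.inv hp))) (S.length hp) fun x h1 h2 => ?_
  rw [entry_inv (S.length (S.inv hp)) h1 h2, pos_inv hp h1 h2]

theorem S.rot (hp : p ∈ S n) : rot p ∈ S n := S.reverse (S.inv hp)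

theorem S.rotInv (hp : p ∈ S n) : rotInv p ∈ S n := S.inv (S.reverse hp)

theorem rot_rotInv (hp : p ∈ S n) : CatalanPerm.rot (CatalanPerm.rotInv p) = p := by
  rw [CatalanPerm.rot, CatalanPerm.rotInv, inv_inv (S.reverse hp), List.reverse_reverse]

theorem rotInv_rot (hp : p ∈ S n) : CatalanPerm.rotInv (CatalanPerm.rot p) = p := by
  rw [CatalanPerm.rot, CatalanPerm.rotInv, List.reverse_reverse, inv_inv hp]

theorem entry_reverse_rotInv (hp : p ∈ S n) {x : ℕ} (h1 : 1 ≤ x) (h2 : x ≤ n) :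
    entry (CatalanPerm.rotInv p).reverse x = n + 1 - pos p (n + 1 - x) := by
  rw [entry_reverse (S.length (S.rotInv hp)) h1 h2, CatalanPerm.rotInv,
    entry_inv (S.length (S.reverse hp)) (by omega) (by omega), pos_reverse hp (by omega) (by omega)]

end Entries

/-! ### Permutations avoiding `132` and `213` -/

/-- `p` avoids the patterns `132` and `213`. -/
def AvoidsBoth (p : List ℕ) : Prop :=
  (p.Triplewise fun a b c => ¬(a < c ∧ c < b)) ∧ p.Triplewise fun a b c => ¬(b < a ∧ a < c)

section AvoidsBoth

variable {n : ℕ} {r : List ℕ}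

/-- The patterns 132 and 213 are involutions. -/
theorem AvoidsBoth.inv (hr : r ∈ S n) (h : AvoidsBoth r) : AvoidsBoth (inv r) := by
  have hl := S.length hr
  have hli := S.length (S.inv hr)
  rw [AvoidsBoth, triplewise_iff_entry hl, triplewise_iff_entry hl] at h
  rw [AvoidsBoth, triplewise_iff_entry hli, triplewise_iff_entry hli]
  have key : ∀ x y z, 1 ≤ x → x < y → y < z → z ≤ n →
      ¬(pos r x < pos r z ∧ pos r z < pos r y) ∧ ¬(pos r y < pos r x ∧ pos r x < pos r z) := by
    intro x y z h1 h2 h3 h4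
    have hx := pos_mem_Icc hr h1 (by omega : x ≤ n)
    have hy := pos_mem_Icc hr (by omega : 1 ≤ y) (by omega)
    have hz := pos_mem_Icc hr (by omega : 1 ≤ z) h4
    constructor
    · rintro ⟨h5, h6⟩
      have := h.1 _ _ _ hx.1 h5 h6 hy.2
      rw [entry_pos hr, entry_pos hr, entry_pos hr] at this <;> omega
    · rintro ⟨h5, h6⟩
      have := h.2 _ _ _ hy.1 h5 h6 hz.2
      rw [entry_pos hr, entry_pos hr, entry_pos hr] at this <;> omega
  constructor
  · intro x y z h1 h2 h3 h4
    rw [entry_inv hl, entry_inv hl, entry_inv hl]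
    · exact (key x y z h1 h2 h3 h4).1
    all_goals omega
  · intro x y z h1 h2 h3 h4
    rw [entry_inv hl, entry_inv hl, entry_inv hl]
    · exact (key x y z h1 h2 h3 h4).2
    all_goals omega

/-- The reverse of `rotInv r` is the reverse complement of `inv r`, and reverse complementation
exchanges 132 and 213. -/
theorem AvoidsBoth.reverse_rotInv (hr : r ∈ S n) (h : AvoidsBoth r) :
    AvoidsBoth (rotInv r).reverse := by
  have hl := S.length hr
  have hli := S.length (S.inv hr)
  have hlr := S.length (S.reverse (S.rotInv hr))
  have h := h.inv hr
  rw [AvoidsBoth, triplewise_iff_entry hli, triplewise_iff_entry hli] at h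
  rw [AvoidsBoth, triplewise_iff_entry hlr, triplewise_iff_entry hlr]
  have key : ∀ x y z, 1 ≤ x → x < y → y < z → z ≤ n → _ := fun x y z h1 h2 h3 h4 =>
    And.intro (h.1 (n + 1 - z) (n + 1 - y) (n + 1 - x) (by omega) (by omega) (by omega) (by omega))
      (h.2 (n + 1 - z) (n + 1 - y) (n + 1 - x) (by omega) (by omega) (by omega) (by omega))
  constructor
  all_goals
    intro x y z h1 h2 h3 h4
    have hk := key x y z h1 h2 h3 h4
    rw [entry_inv hl, entry_inv hl, entry_inv hl] at hk
    any_goals omega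
    have hx := pos_mem_Icc hr (by omega : 1 ≤ n + 1 - x) (by omega)
    have hy := pos_mem_Icc hr (by omega : 1 ≤ n + 1 - y) (by omega)
    have hz := pos_mem_Icc hr (by omega : 1 ≤ n + 1 - z) (by omega)
    rw [entry_reverse_rotInv hr, entry_reverse_rotInv hr, entry_reverse_rotInv hr] <;> omega

/-- At a descent `i` every earlier entry exceeds every later one: 132 handles the entries before
`i`, 213 those after `i + 1`. By counting, the first `i` entries are then the `i` largest values,
and the value `n + 1 - i` precedes `n - i`. -/
theorem AvoidsBoth.pos_lt_pos (hr : r ∈ S n) (h : AvoidsBoth r) {i : ℕ} (h1 : 1 ≤ i) (h2 : i < n)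
    (hd : entry r (i + 1) < entry r i) : pos r (n + 1 - i) < pos r (n - i) := by
  have hl := S.length hr
  rw [AvoidsBoth, triplewise_iff_entry hl, triplewise_iff_entry hl] at h
  have cross : ∀ x y, 1 ≤ x → x ≤ i → i < y → y ≤ n → entry r y < entry r x := by
    intro x y hx1 hx2 hy1 hy2
    have hlt : entry r (i + 1) < entry r x := by
      rcases eq_or_lt_of_le hx2 with rfl | hx2
      · exact hd
      · have ha := h.1 x i (i + 1) hx1 hx2 (by omega) (by omega)
        have hb : entry r x ≠ entry r (i + 1) := fun e => by
          have := entry_injOn hr hx1 (by omega) (by omega) (by omega) e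
          omega
        omega
    rcases eq_or_lt_of_le (Nat.succ_le_of_lt hy1) with rfl | hy
    · exact hlt
    · have ha := h.2 x (i + 1) y hx1 (by omega) hy hy2
      have hb : entry r x ≠ entry r y := fun e => by
        have := entry_injOn hr hx1 (by omega) (by omega) (by omega) e
        omega
      omega
  have inj : ∀ a b, 1 ≤ a → b ≤ n → Set.InjOn (entry r) (Finset.Icc a b) := by
    intro a b ha hb x hx y hy e
    simp only [Finset.coe_Icc, Set.mem_Icc] at hx hy
    exact entry_injOn hr (by omega) (by omega) (by omega) (by omega) e
  have hhigh : ∀ y, i < y → y ≤ n → entry r y ≤ n - i := by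
    intro y hy1 hy2
    have := Finset.card_le_card_of_injOn (s := Finset.Icc 1 i) (t := Finset.Icc (entry r y + 1) n)
      (entry r) (fun x hx => by
        simp only [Finset.coe_Icc, Set.mem_Icc] at hx ⊢
        exact ⟨cross x y hx.1 hx.2 hy1 hy2, (entry_mem_Icc hr hx.1 (by omega)).2⟩)
      (inj 1 i le_rfl (by omega))
    simp only [Nat.card_Icc] at this
    omega
  have hlow : ∀ x, 1 ≤ x → x ≤ i → n + 1 - i ≤ entry r x := by
    intro x hx1 hx2
    have := Finset.card_le_card_of_injOn (s := Finset.Icc (i + 1) n)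
      (t := Finset.Icc 1 (entry r x - 1)) (entry r) (fun y hy => by
        simp only [Finset.coe_Icc, Set.mem_Icc] at hy ⊢
        have := cross x y hx1 hx2 hy.1 hy.2
        have := (entry_mem_Icc hr (by omega : 1 ≤ y) hy.2).1
        omega)
      (inj (i + 1) n (by omega) le_rfl)
    simp only [Nat.card_Icc] at this
    omega
  have ha := pos_mem_Icc hr (by omega : 1 ≤ n + 1 - i) (by omega)
  have hb := pos_mem_Icc hr (by omega : 1 ≤ n - i) (by omega)
  have hea := entry_pos hr (by omega : 1 ≤ n + 1 - i) (by omega)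
  have heb := entry_pos hr (by omega : 1 ≤ n - i) (by omega)
  have h3 : pos r (n + 1 - i) ≤ i := by
    by_contra hc
    have := hhigh _ (not_le.1 hc) ha.2
    omega
  have h4 : i < pos r (n - i) := by
    by_contra hc
    have := hlow _ hb.1 (not_lt.1 hc)
    omega
  omega

/-- A descent at `i` on the left says that `n + 1 - i` precedes `n - i` in `r`, that is, `inv r`
descends at `n - i`. So `AvoidsBoth.pos_lt_pos` for `r` gives one direction, and for `inv r` the
other. -/
theorem AvoidsBoth.stepWord_reverse_rotInv (hr : r ∈ S n) (h : AvoidsBoth r) :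
    stepWord (rotInv r).reverse = stepWord r := by
  refine stepWord_eq_of_entry (S.length (S.reverse (S.rotInv hr))) (S.length hr)
    fun i h1 h2 => ?_
  rw [entry_reverse_rotInv hr (by omega) h2, entry_reverse_rotInv hr h1 h2.le,
    show n + 1 - (i + 1) = n - i by omega]
  have ha := pos_mem_Icc hr (by omega : 1 ≤ n + 1 - i) (by omega)
  have hb := pos_mem_Icc hr (by omega : 1 ≤ n - i) (by omega)
  constructor
  · intro hlt
    have := (h.inv hr).pos_lt_pos (S.inv hr) (i := n - i) (by omega) (by omega) (by
      rw [entry_inv (S.length hr) (by omega) (by omega),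
        entry_inv (S.length hr) (by omega) (by omega), show n - i + 1 = n + 1 - i by omega]
      omega)
    rw [pos_inv hr (by omega) (by omega), pos_inv hr (by omega) (by omega)] at this
    rwa [show n + 1 - (n - i) = i + 1 by omega, show n - (n - i) = i by omega] at this
  · intro hd
    have := h.pos_lt_pos hr h1 h2 hd
    omega

end AvoidsBoth

/-! ### The sliding operators -/

theorem countP_lt_countP {α : Type*} {P Q : α → Bool} {l : List α} (h : ∀ x ∈ l, P x → Q x)
    {a : α} (ha : a ∈ l) (hQ : Q a) (hP : ¬P a) : l.countP P < l.countP Q := by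
  obtain ⟨l₁, l₂, rfl⟩ := List.append_of_mem ha
  rw [List.countP_append, List.countP_append, List.countP_cons_of_pos hQ,
    List.countP_cons_of_neg hP]
  have h1 := List.countP_mono_left fun x hx => h x (List.mem_append_left _ hx)
  have h2 := List.countP_mono_left fun x hx =>
    h x (List.mem_append_right _ (List.mem_cons_of_mem _ hx))
  omega

theorem countP_lt_range' (i n : ℕ) (h : i ≤ n) :
    (List.range' 1 n).countP (fun v => v < i + 1) = i := by
  induction n with
  | zero => simp; omega
  | succ n ih =>
    rw [List.range'_concat, List.countP_append, List.countP_singleton]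
    rcases Nat.lt_or_ge n i with hi | hi
    · obtain rfl : i = n + 1 := by omega
      rw [List.countP_eq_length.2]
      · simp [Nat.add_comm]
      · intro a ha
        rw [List.mem_range'_1] at ha
        simp; omega
    · rw [ih hi, if_neg (by simp; omega)]
      omega

/-- The map on letters that defines `swuAt i p`. -/
def swuLetter (i : ℕ) (p : List ℕ) (v : ℕ) : ℕ :=
  if i ≤ v then v
  else if v ∈ rightSmaller i p then (rightSmaller i p).countP fun u => u ≤ v
  else i - (leftSmaller i p).countP fun u => v ≤ u

theorem swuAt_eq_map (i : ℕ) (p : List ℕ) : swuAt i p = p.map (swuLetter i p) := rfl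

section Sliding

variable {n i : ℕ} {p : List ℕ}

theorem pos_lt_pos_iff_mem_take (hp : p ∈ S n) {u v : ℕ} (hu : 1 ≤ u) (hu' : u ≤ n) :
    u ∈ p.take (p.idxOf v) ↔ pos p u < pos p v := by
  have hu := (S.mem_iff hp).2 ⟨hu, hu'⟩
  have := List.idxOf_lt_length_of_mem hu
  rw [List.mem_take_iff_getElem]
  constructor
  · rintro ⟨j, hj, rfl⟩
    have := (S.nodup hp).idxOf_getElem j (by omega)
    simp only [pos, this]; omega
  · intro h
    simp only [pos] at h
    exact ⟨p.idxOf u, by omega, List.getElem_idxOf _⟩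

theorem mem_leftSmaller (hp : p ∈ S n) (hi' : i ≤ n) {v : ℕ} (hv : 1 ≤ v) :
    v ∈ leftSmaller i p ↔ v < i ∧ pos p v < pos p i := by
  rw [leftSmaller, List.mem_filter, decide_eq_true_eq]
  constructor
  · rintro ⟨h1, h2⟩
    exact ⟨h2, (pos_lt_pos_iff_mem_take hp hv (by omega)).1 h1⟩
  · rintro ⟨h1, h2⟩
    exact ⟨(pos_lt_pos_iff_mem_take hp hv (by omega)).2 h2, h1⟩

theorem mem_rightSmaller (hp : p ∈ S n) (hi : 1 ≤ i) (hi' : i ≤ n) {v : ℕ} (hv : 1 ≤ v) :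
    v ∈ rightSmaller i p ↔ v < i ∧ pos p i < pos p v := by
  rw [rightSmaller, List.mem_filter, decide_eq_true_eq, and_comm]
  refine and_congr_right fun hvi => ?_
  have hne : pos p v ≠ pos p i := fun e => by
    have := pos_injOn hp hv (by omega) hi hi' e
    omega
  have hmem : v ∈ p.take (p.idxOf i) ∨ v ∈ p.drop (p.idxOf i) := by
    rw [← List.mem_append, List.take_append_drop, S.mem_iff hp]; omega
  have hdis : v ∈ p.take (p.idxOf i) → v ∈ p.drop (p.idxOf i) → False := by
    have := S.nodup hp
    rw [← List.take_append_drop (p.idxOf i) p, List.nodup_append] at this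
    exact fun h1 h2 => this.2.2 _ h1 _ h2 rfl
  rw [pos_lt_pos_iff_mem_take hp hv (by omega)] at hmem hdis
  constructor
  · intro h
    have : ¬pos p v < pos p i := fun h' => hdis h' h
    omega
  · intro h
    exact hmem.resolve_left (by omega)

theorem length_leftSmaller_add (hp : p ∈ S n) (hi : 1 ≤ i) (hi' : i ≤ n) :
    (leftSmaller i p).length + (rightSmaller i p).length + 1 = i := by
  rw [leftSmaller, rightSmaller, ← List.length_append, ← List.filter_append,
    List.take_append_drop, ← List.countP_eq_length_filter,
    List.Perm.countP_eq _ (show p.Perm (List.range' 1 n) from hp)]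
  obtain ⟨i, rfl⟩ := Nat.exists_eq_add_of_le' hi
  rw [countP_lt_range' i n (by omega)]

theorem swuLetter_of_le {v : ℕ} (h : i ≤ v) : swuLetter i p v = v := if_pos h

theorem swuLetter_right (hp : p ∈ S n) (hi : 1 ≤ i) (hi' : i ≤ n) {v : ℕ} (hv : 1 ≤ v)
    (hvi : v < i) (h : pos p i < pos p v) :
    swuLetter i p v = (rightSmaller i p).countP fun u => u ≤ v := by
  rw [swuLetter, if_neg (by omega), if_pos ((mem_rightSmaller hp hi hi' hv).2 ⟨hvi, h⟩)]

theorem swuLetter_left (hp : p ∈ S n) (hi : 1 ≤ i) (hi' : i ≤ n) {v : ℕ} (hv : 1 ≤ v)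
    (hvi : v < i) (h : pos p v < pos p i) :
    swuLetter i p v = i - (leftSmaller i p).countP fun u => v ≤ u := by
  rw [swuLetter, if_neg (by omega), if_neg]
  rw [mem_rightSmaller hp hi hi' hv]
  omega

theorem pos_lt_or_gt (hp : p ∈ S n) (hi' : i ≤ n) {v : ℕ} (hv : 1 ≤ v) (hvi : v < i) :
    pos p v < pos p i ∨ pos p i < pos p v := by
  have : pos p v ≠ pos p i := fun e => by
    have := pos_injOn hp hv (by omega) (by omega) hi' e
    omega
  omega

theorem swuLetter_right_bounds (hp : p ∈ S n) (hi : 1 ≤ i) (hi' : i ≤ n) {v : ℕ} (hv : 1 ≤ v)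
    (hvi : v < i) (h : pos p i < pos p v) :
    1 ≤ swuLetter i p v ∧ swuLetter i p v ≤ (rightSmaller i p).length := by
  rw [swuLetter_right hp hi hi' hv hvi h]
  refine ⟨List.countP_pos_iff.2 ⟨v, ?_, by simp⟩, List.countP_le_length⟩
  exact (mem_rightSmaller hp hi hi' hv).2 ⟨hvi, h⟩

theorem swuLetter_left_bounds (hp : p ∈ S n) (hi : 1 ≤ i) (hi' : i ≤ n) {v : ℕ} (hv : 1 ≤ v)
    (hvi : v < i) (h : pos p v < pos p i) :
    (rightSmaller i p).length < swuLetter i p v ∧ swuLetter i p v < i := by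
  rw [swuLetter_left hp hi hi' hv hvi h]
  have h1 : 0 < (leftSmaller i p).countP fun u => v ≤ u :=
    List.countP_pos_iff.2 ⟨v, (mem_leftSmaller hp hi' hv).2 ⟨hvi, h⟩, by simp⟩
  have h2 : ((leftSmaller i p).countP fun u => v ≤ u) ≤ (leftSmaller i p).length :=
    List.countP_le_length
  have h3 := length_leftSmaller_add hp hi hi'
  omega

theorem swuLetter_bounds (hp : p ∈ S n) (hi : 1 ≤ i) (hi' : i ≤ n) {v : ℕ} (hv : 1 ≤ v)
    (hvi : v < i) : 1 ≤ swuLetter i p v ∧ swuLetter i p v < i := by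
  have h3 := length_leftSmaller_add hp hi hi'
  rcases pos_lt_or_gt hp hi' hv hvi with h | h
  · have := swuLetter_left_bounds hp hi hi' hv hvi h
    omega
  · have := swuLetter_right_bounds hp hi hi' hv hvi h
    omega

/-- With `ρ` letters below `i` to the right of `i`, these receive the values `1, …, ρ`, and those to
the left receive `ρ + 1, …, i - 1`. -/
theorem swuLetter_lt_of_sides (hp : p ∈ S n) (hi : 1 ≤ i) (hi' : i ≤ n) {v w : ℕ} (hv : 1 ≤ v)
    (hvi : v < i) (hw : 1 ≤ w) (hwi : w < i) (h1 : pos p v < pos p i) (h2 : pos p i < pos p w) :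
    swuLetter i p w < swuLetter i p v := by
  have h3 := swuLetter_left_bounds hp hi hi' hv hvi h1
  have h4 := swuLetter_right_bounds hp hi hi' hw hwi h2
  omega

/-- Sliding changes the relative order of two letters only if the smaller one is to the left and
the larger one to the right of `i`. -/
theorem swuLetter_lt (hp : p ∈ S n) (hi : 1 ≤ i) (hi' : i ≤ n) {v w : ℕ} (hv : 1 ≤ v)
    (hvw : v < w) (h : ¬(w < i ∧ pos p v < pos p i ∧ pos p i < pos p w)) :
    swuLetter i p v < swuLetter i p w := by
  rcases Nat.lt_or_ge w i with hwi | hwi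
  · have hvi : v < i := by omega
    have hw : 1 ≤ w := by omega
    rcases pos_lt_or_gt hp hi' hw hwi with h1 | h1
    · rcases pos_lt_or_gt hp hi' hv hvi with h2 | h2
      · have h3 := swuLetter_left_bounds hp hi hi' hv hvi h2
        rw [swuLetter_left hp hi hi' hv hvi h2] at h3 ⊢
        rw [swuLetter_left hp hi hi' hw hwi h1]
        have : ((leftSmaller i p).countP fun u => w ≤ u) <
            (leftSmaller i p).countP fun u => v ≤ u :=
          countP_lt_countP (a := v) (by simp; omega)
            ((mem_leftSmaller hp hi' hv).2 ⟨hvi, h2⟩) (by simp) (by simpa using hvw)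
        omega
      · exact swuLetter_lt_of_sides hp hi hi' hw hwi hv hvi h1 h2
    · rcases pos_lt_or_gt hp hi' hv hvi with h2 | h2
      · exact absurd ⟨hwi, h2, h1⟩ h
      · rw [swuLetter_right hp hi hi' hv hvi h2, swuLetter_right hp hi hi' hw hwi h1]
        exact countP_lt_countP (a := w) (by simp; omega)
          ((mem_rightSmaller hp hi hi' hw).2 ⟨hwi, h1⟩) (by simp) (by simpa using hvw)
  · rw [swuLetter_of_le hwi]
    rcases Nat.lt_or_ge v i with hvi | hvi
    · have := swuLetter_bounds hp hi hi' hv hvi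
      omega
    · rwa [swuLetter_of_le hvi]

theorem swuLetter_injOn (hp : p ∈ S n) (hi : 1 ≤ i) (hi' : i ≤ n) {v w : ℕ} (hv : 1 ≤ v)
    (hw : 1 ≤ w) (e : swuLetter i p v = swuLetter i p w) : v = w := by
  have key : ∀ v w, 1 ≤ v → v < w → swuLetter i p v ≠ swuLetter i p w := by
    intro v w hv hvw
    by_cases h : w < i ∧ pos p v < pos p i ∧ pos p i < pos p w
    · exact (swuLetter_lt_of_sides hp hi hi' hv (by omega) (by omega) h.1 h.2.1 h.2.2).ne'
    · exact (swuLetter_lt hp hi hi' hv hvw h).ne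
  rcases lt_trichotomy v w with h | h | h
  · exact absurd e (key v w hv h)
  · exact h
  · exact absurd e.symm (key w v hw h)

theorem S.swuAt (hp : p ∈ S n) (hi : 1 ≤ i) (hi' : i ≤ n) : swuAt i p ∈ S n := by
  rw [swuAt_eq_map]
  refine mem_S_of ?_ (by simp [S.length hp]) fun v hv => ?_
  · refine List.Nodup.map_on (fun v hv w hw e => ?_) (S.nodup hp)
    rw [S.mem_iff hp] at hv hw
    exact swuLetter_injOn hp hi hi' hv.1 hw.1 e
  · obtain ⟨v, hv', rfl⟩ := List.mem_map.1 hv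
    rw [S.mem_iff hp] at hv'
    rcases Nat.lt_or_ge v i with h | h
    · have := swuLetter_bounds hp hi hi' hv'.1 h
      omega
    · rwa [swuLetter_of_le h]

theorem entry_swuAt (hp : p ∈ S n) {x : ℕ} (h1 : 1 ≤ x) (h2 : x ≤ n) :
    entry (CatalanPerm.swuAt i p) x = swuLetter i p (entry p x) :=
  entry_map _ h1 (by rwa [S.length hp])

theorem entry_swuAt_lt (hp : p ∈ S n) (hi : 1 ≤ i) (hi' : i ≤ n) {x y : ℕ} (h1 : 1 ≤ x)
    (h2 : x ≤ n) (h3 : 1 ≤ y) (h4 : y ≤ n) (h : entry p x < entry p y)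
    (hc : ¬(entry p y < i ∧ x < pos p i ∧ pos p i < y)) :
    entry (CatalanPerm.swuAt i p) x < entry (CatalanPerm.swuAt i p) y := by
  rw [entry_swuAt hp h1 h2, entry_swuAt hp h3 h4]
  refine swuLetter_lt hp hi hi' (entry_mem_Icc hp h1 h2).1 h ?_
  rwa [pos_entry hp h1 h2, pos_entry hp h3 h4]

theorem entry_swuAt_lt_of_sides (hp : p ∈ S n) (hi : 1 ≤ i) (hi' : i ≤ n) {x y : ℕ} (h1 : 1 ≤ x)
    (h4 : y ≤ n) (hx : entry p x < i) (hy : entry p y < i) (hxi : x < pos p i)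
    (hiy : pos p i < y) :
    entry (CatalanPerm.swuAt i p) y < entry (CatalanPerm.swuAt i p) x := by
  rw [entry_swuAt hp h1 (by omega), entry_swuAt hp (by omega) h4]
  refine swuLetter_lt_of_sides hp hi hi' (entry_mem_Icc hp h1 (by omega)).1 hx
    (entry_mem_Icc hp (by omega) h4).1 hy ?_ ?_
  · rwa [pos_entry hp h1 (by omega)]
  · rwa [pos_entry hp (by omega) h4]

theorem entry_swuAt_eq_or_lt (hp : p ∈ S n) (hi : 1 ≤ i) (hi' : i ≤ n) {x : ℕ} (h1 : 1 ≤ x)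
    (h2 : x ≤ n) : (i ≤ entry p x ∧ entry (CatalanPerm.swuAt i p) x = entry p x) ∨
      (entry p x < i ∧ entry (CatalanPerm.swuAt i p) x < i) := by
  rw [entry_swuAt hp h1 h2]
  rcases Nat.lt_or_ge (entry p x) i with h | h
  · exact .inr ⟨h, (swuLetter_bounds hp hi hi' (entry_mem_Icc hp h1 h2).1 h).2⟩
  · exact .inl ⟨h, swuLetter_of_le h⟩

/-- The properties of a word from which the letters `n, …, i` have been slid. -/
structure Slid (n i : ℕ) (w : List DyckStep) (p : List ℕ) : Prop where
  mem : p ∈ S n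
  stepWord_eq : stepWord p = w
  avoids : ∀ x y z, 1 ≤ x → x < y → y < z → z ≤ n →
    ¬(entry p y < entry p x ∧ entry p x < entry p z)
  -- Patterns 132 with largest letter at least `i` are excluded: vacuous for `i = n + 1`, full
  -- avoidance of 132 for `i = 1`.
  avoids_of_le : ∀ x y z, 1 ≤ x → x < y → y < z → z ≤ n → i ≤ entry p y →
    ¬(entry p x < entry p z ∧ entry p z < entry p y)

/-- Sliding preserves every descending pair and reverses only ascending pairs of letters below `i`
that lie on both sides of `i`. -/
theorem Slid.slide {w : List DyckStep} (h : Slid n (i + 1) w p) (hi : 1 ≤ i) (hi' : i ≤ n) :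
    Slid n i w (swuAt i p) := by
  have hp := h.mem
  have hq := S.swuAt hp hi hi'
  have hne : ∀ x y, 1 ≤ x → x < y → y ≤ n → entry p x ≠ entry p y := fun x y h1 h2 h3 e => by
    have := entry_injOn hp h1 (by omega) (by omega) h3 e
    omega
  have hdesc : ∀ x y, 1 ≤ x → x < y → y ≤ n → entry p y < entry p x →
      entry (CatalanPerm.swuAt i p) y < entry (CatalanPerm.swuAt i p) x :=
    fun x y h1 h2 h3 h4 =>
      entry_swuAt_lt hp hi hi' (by omega) h3 h1 (by omega) h4 (by omega)
  have hasc : ∀ x y, 1 ≤ x → x < y → y ≤ n → entry p x < entry p y →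
      ¬(entry p y < i ∧ x < pos p i ∧ pos p i < y) →
      entry (CatalanPerm.swuAt i p) x < entry (CatalanPerm.swuAt i p) y :=
    fun x y h1 h2 h3 h4 => entry_swuAt_lt hp hi hi' h1 (by omega) (by omega) h3 h4
  have hpi := pos_mem_Icc hp hi hi'
  have hei := entry_pos hp hi hi'
  refine ⟨hq, ?_, ?_, ?_⟩
  · rw [← h.stepWord_eq]
    refine stepWord_eq_of_entry (S.length hq) (S.length hp) fun x h1 h2 => ?_
    constructor
    · intro h3
      -- Adjacent positions cannot have `i` strictly between them.
      by_contra hc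
      have := hne x (x + 1) h1 (by omega) (by omega)
      have := hasc x (x + 1) h1 (by omega) (by omega) (by omega) (by omega)
      omega
    · exact hdesc x (x + 1) h1 (by omega) (by omega)
  · rintro x y z h1 h2 h3 h4 ⟨h5, h6⟩
    have hxz : entry p x < entry p z := by
      by_contra hc
      have := hne x z h1 (by omega) h4
      have := hdesc x z h1 (by omega) h4 (by omega)
      omega
    have hxy : entry p x < entry p y := by
      by_contra hc
      have := hne x y h1 h2 (by omega)
      exact h.avoids x y z h1 h2 h3 h4 ⟨by omega, hxz⟩
    -- A new 213 can only come from a triple whose first two entries were reversed by the slide.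
    have hflip : entry p y < i ∧ x < pos p i ∧ pos p i < y := by
      by_contra hc
      have := hasc x y h1 h2 (by omega) hxy hc
      omega
    -- If the third letter is below `i`, it was reversed with the first one too. Otherwise `i` could
    -- replace the first letter and give a 213 already in `p`.
    rcases Nat.lt_or_ge (entry p z) i with hz | hz
    · have := entry_swuAt_lt_of_sides hp hi hi' h1 h4 (by omega) hz hflip.2.1 (by omega)
      omega
    · have := hne (pos p i) z hpi.1 (by omega) h4
      exact h.avoids (pos p i) y z hpi.1 hflip.2.2 h3 h4 ⟨by omega, by omega⟩
  · rintro x y z h1 h2 h3 h4 h5 ⟨h6, h7⟩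
    have hxz : entry p x < entry p z := by
      by_contra hc
      have := hne x z h1 (by omega) h4
      have := hdesc x z h1 (by omega) h4 (by omega)
      omega
    have hy := entry_swuAt_eq_or_lt hp hi hi' (by omega : 1 ≤ y) (by omega)
    have hx := entry_swuAt_eq_or_lt hp hi hi' h1 (by omega : x ≤ n)
    have hz := entry_swuAt_eq_or_lt hp hi hi' (by omega : 1 ≤ z) h4
    -- If the peak is `i`, the outer letters lie on both sides of it and are now descending. A
    -- larger peak was excluded before the slide.
    rcases eq_or_ne (entry p y) i with e | e
    · have hpy : pos p i = y := by rw [← e, pos_entry hp (by omega) (by omega)]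
      have := entry_swuAt_lt_of_sides hp hi hi' h1 h4 (by omega) (by omega)
        (by omega : x < pos p i) (by omega)
      omega
    · refine h.avoids_of_le x y z h1 h2 h3 h4 (by omega) ⟨hxz, ?_⟩
      by_contra hc
      have := hne y z (by omega) h3 h4
      have := hasc y z (by omega) h3 h4 (by omega) (by omega)
      omega

theorem Slid.foldr_swuAt {w : List DyckStep} (h : Slid n (n + 1) w p) (m s : ℕ) (hs : 1 ≤ s)
    (hm : s + m = n + 1) : Slid n s w ((List.range' s m).foldr swuAt p) := by
  induction m generalizing s with
  | zero =>
    obtain rfl : s = n + 1 := by omega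
    exact h
  | succ m ih =>
    rw [List.range'_succ, List.foldr_cons]
    exact (ih (s + 1) (by omega) (by omega)).slide hs (by omega)

/-- Each `swl_i` is a conjugate of `swu_i` by `rot`, so the inner rotations cancel. -/
theorem foldr_swlAt (hp : p ∈ S n) (l : List ℕ) (hl : ∀ i ∈ l, 1 ≤ i ∧ i ≤ n) :
    l.foldr swlAt p = rotInv (l.foldr swuAt (rot p)) ∧ l.foldr swuAt (rot p) ∈ S n := by
  induction l with
  | nil => exact ⟨(rotInv_rot hp).symm, S.rot hp⟩
  | cons i l ih =>
    obtain ⟨h1, h2⟩ := ih fun j hj => hl j (List.mem_cons_of_mem _ hj)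
    have := hl i (by simp)
    rw [List.foldr_cons, List.foldr_cons, h1, swlAt, rot_rotInv h2]
    exact ⟨rfl, S.swuAt h2 this.1 this.2⟩

/-- On a permutation whose rotation avoids `213`, `swl` produces the rotation of a permutation
with the same descents that avoids both `132` and `213`. -/
theorem exists_swl_eq_rotInv (hp : p ∈ S n)
    (h : (rot p).Triplewise fun a b c => ¬(b < a ∧ a < c)) :
    ∃ r ∈ S n, swl p = rotInv r ∧ AvoidsBoth r ∧ stepWord r = stepWord (rot p) := by
  have hr := S.rot hp
  rw [triplewise_iff_entry (S.length hr)] at h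
  have h0 : Slid n (n + 1) (stepWord (rot p)) (rot p) := by
    refine ⟨hr, rfl, h, fun x y z h1 h2 h3 h4 h5 => ?_⟩
    have := entry_mem_Icc hr (by omega : 1 ≤ y) (by omega)
    omega
  have h1 := h0.foldr_swuAt n 1 le_rfl (by omega)
  refine ⟨_, h1.mem, ?_, ⟨?_, ?_⟩, h1.stepWord_eq⟩
  · rw [swl, S.length hp]
    exact (foldr_swlAt hp _ fun i hi => by rw [List.mem_range'_1] at hi; omega).1
  · rw [triplewise_iff_entry (S.length h1.mem)]
    exact fun x y z h2 h3 h4 h5 =>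
      h1.avoids_of_le x y z h2 h3 h4 h5 (entry_mem_Icc h1.mem (by omega) (by omega)).1
  · rw [triplewise_iff_entry (S.length h1.mem)]
    exact h1.avoids

end Sliding

/-! ### The bijection -/

theorem mem_U_iff_exists_valley (k : ℕ) (p : List ℕ) :
    p ∈ U (2 * k + 1) {[1, 3, 2], [2, 3, 1]} ↔
      ∃ w : DyckWord, w.semilength = k ∧ valley w.toList = p := by
  constructor
  · rintro ⟨hp, hf, ha⟩
    rw [avoids_132_231_iff (S.nodup hp)] at ha
    obtain ⟨w, hw, rfl⟩ := exists_valley_eq (2 * k) p hp ha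
    obtain ⟨h1, h2⟩ := (fertility_valley w).1 hf
    refine ⟨⟨w, h1, h2⟩, ?_, rfl⟩
    have := DyckWord.two_mul_semilength_eq_length (p := ⟨w, h1, h2⟩)
    simp only at this
    omega
  · rintro ⟨w, rfl, rfl⟩
    have hS := valley_mem_S w.toList
    rw [← DyckWord.two_mul_semilength_eq_length] at hS
    exact ⟨hS, (fertility_valley _).2 ⟨w.count_U_eq_count_D, w.count_D_le_count_U⟩,
      (avoids_132_231_iff (S.nodup hS)).2 (triplewise_valley _)⟩

theorem swl_valley (w : DyckWord) :
    swl (valley w.toList) ∈ U (2 * w.semilength + 1) {[3, 1, 2]} ∧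
      DL w.semilength (swl (valley w.toList)) = (w.toList, w.toList) := by
  have hS := valley_mem_S w.toList
  rw [← DyckWord.two_mul_semilength_eq_length] at hS
  obtain ⟨r, hr, e, ha, hw⟩ := exists_swl_eq_rotInv hS (triplewise_rot_valley _)
  rw [stepWord_rot_valley] at hw
  have hσ := S.rotInv hr
  have hne : rotInv r ≠ [] := fun h => by
    have := S.length hσ
    simp [h] at this
  have haσ := ha.reverse_rotInv hr
  have hwσ := (ha.stepWord_reverse_rotInv hr).trans hw
  rw [e]
  refine ⟨⟨hσ, ?_, ?_⟩, ?_⟩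
  · rw [fertility_eq_one_iff_tight (S.isPermWord hσ) hne]
    constructor
    · obtain ⟨q, hq⟩ := exists_sortsTo_reverse w (rotInv r).reverse
        (List.nodup_reverse.2 (S.nodup hσ)) (by simpa using hne) haσ.1 haσ.2 hwσ
      exact ⟨q, by simpa using hq⟩
    -- The descents number the letters `D` of `w`, which is its semilength; this is the tight case
    -- of the criterion.
    · rw [← (count_stepWord_reverse _ (S.nodup hσ)).1, hwσ, S.length hσ,
        ← w.semilength_eq_count_D]
  · simp only [Set.mem_singleton_iff, forall_eq]
    refine not_containsPattern_312 ?_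
    have := haσ.2
    rw [List.triplewise_reverse] at this
    exact this.imp fun h1 h2 => h1 h2
  · rw [DL_eq _ _ hσ, rot_rotInv hr, hwσ, hw]

theorem mem_IntAntichain {k : ℕ} {P : List DyckStep × List DyckStep} :
    P ∈ IntAntichain k ↔ ∃ w : DyckWord, w.semilength = k ∧ (w.toList, w.toList) = P := by
  constructor
  · rintro ⟨I, rfl⟩
    have h : I.fst = I.snd := I.fst_le_snd
    exact ⟨I.fst.val, I.fst.property, Prod.ext rfl (by rw [h])⟩
  · rintro ⟨w, hw, rfl⟩
    exact ⟨⟨⟨⟨w, hw⟩, ⟨w, hw⟩⟩, rfl⟩, rfl⟩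

theorem ncard_IntAntichain (k : ℕ) : (IntAntichain k).ncard = catalan k := by
  have e : IntAntichain k = Set.range fun w : {w : DyckWord // w.semilength = k} =>
      (w.val.toList, w.val.toList) := by
    ext P
    rw [mem_IntAntichain]
    simp
  rw [e, ← Set.image_univ, Set.ncard_image_of_injective, Set.ncard_univ,
    Nat.card_eq_fintype_card, DyckWord.card_dyckWord_semilength_eq_catalan]
  intro v w h
  exact Subtype.ext (DyckWord.ext (Prod.ext_iff.1 h).1)

end CatalanPerm
open CatalanPerm in
theorem theorem7 (k : ℕ) :
    Set.MapsTo swl (U (2 * k + 1) {[1, 3, 2], [2, 3, 1]}) (U (2 * k + 1) {[3, 1, 2]}) ∧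
    Set.BijOn (DL k ∘ swl) (U (2 * k + 1) {[1, 3, 2], [2, 3, 1]}) (IntAntichain k) ∧
    (U (2 * k + 1) {[1, 3, 2], [2, 3, 1]}).ncard = catalan k := by
  have hbij : Set.BijOn (DL k ∘ swl) (U (2 * k + 1) {[1, 3, 2], [2, 3, 1]}) (IntAntichain k) := by
    refine ⟨?_, ?_, ?_⟩
    · intro p hp
      obtain ⟨w, rfl, rfl⟩ := (mem_U_iff_exists_valley k p).1 hp
      exact mem_IntAntichain.2 ⟨w, rfl, (swl_valley w).2.symm⟩
    · intro p hp q hq h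
      obtain ⟨v, rfl, rfl⟩ := (mem_U_iff_exists_valley k p).1 hp
      obtain ⟨w, hw, rfl⟩ := (mem_U_iff_exists_valley _ q).1 hq
      have hv' := (swl_valley v).2
      have hw' := (swl_valley w).2
      rw [hw] at hw'
      have e := hv'.symm.trans (h.trans hw')
      exact congrArg valley (Prod.ext_iff.1 e).1
    · intro P hP
      obtain ⟨w, rfl, rfl⟩ := mem_IntAntichain.1 hP
      exact ⟨_, (mem_U_iff_exists_valley _ _).2 ⟨w, rfl, rfl⟩, (swl_valley w).2⟩
  refine ⟨fun p hp => ?_, hbij, ?_⟩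
  · obtain ⟨w, rfl, rfl⟩ := (mem_U_iff_exists_valley k p).1 hp
    exact (swl_valley w).1
  · rw [← ncard_IntAntichain k, ← hbij.image_eq, hbij.injOn.ncard_image]
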